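/- Let $q$ be an odd prime power, let $\alpha\in\mathbb F_q$ be a nonsquare and let $\beta\in\mathbb F_{q^2}$ satisfy $\beta^2=\alpha$, so that $\mathbb F_{q^2}=\{x+\beta y: x,y\in\mathbb F_q\}$. Write $\overline z=z^q$ for $z\in\mathbb F_{q^2}$, let $A^*$ be the conjugate transpose of a matrix $A$, and put $\langle u,v\rangle=v^*u=\sum_i\overline{v_i}u_i$. For $A\in M_2(\mathbb F_{q^2})$ let $$W(A)=\{\langle Av,v\rangle: v\in\mathbb F_{q^2}^2,\ \langle v,v\rangle=1\},\qquad F_A(x:y:t)=\det\Bigl(x\,\tfrac{A+A^*}{2}+y\,\tfrac{A-A^*}{2\beta}+tI\Bigr),$$ let $\Gamma_{F}\subset\mathbb P^2(\mathbb F_{q^2})$ be the zero set of $F=F_A$, and let the boundary generating curve $\Gamma_F^\wedge$ be its dual curve, i.e. the set of points $(F_x(P):F_y(P):F_t(P))$, where $P$ runs through the nonsingular points of $\Gamma_F$. The $\mathbb F_q$-affine points $(x:y:1)$, $x,y\in\mathbb F_q$, of a curve in $\mathbb P^2(\mathbb F_{q^2})$ are identified with the elements $x+\beta y$ of $\mathbb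 F_{q^2}$. A smooth conic defined over $\mathbb F_q$ is called an ellipse (respectively, a hyperbola) if it has no (respectively, exactly two) $\mathbb F_q$-rational points on the line at infinity $t=0$. Assume that $F_A$ is nonsingular, and that $A$ has an eigenvalue in $\mathbb F_{q^2}$ with an eigenvector $u\in\mathbb F_{q^2}^2$ such that $\langle u,u\rangle\ne 0$. Then there are $\rho,\tau\in\mathbb F_{q^2}$ with $\rho\neq0$, elements $a,b,c\in\mathbb F_q$ with $ab\ne0$, and scalars $d_1,\dots,d_{(q+1)/2}\in\mathbb F_q$ such that, if $\mathcal C_i$ denotes the projective curve which in the coordinates $X,Y$ given by $X+\beta Y=\rho(x+\beta y)+\tau$ has the affine equation $$\mathcal C_i:\quad \frac{(X-c)^2}{a}-\alpha\,\frac{Y^2}{b}=d_i ,$$ and $\mathcal C_i^{\mathrm{aff}}\subseteq\mathbb F_{q^2}$ denotes the set of its $\mathbb F_q$-affine points, the following hold. 1. $\Gamma_F^\wedge=\mathcal C_1$, and this curve is an ellipse or a hyperbola. 2. $W(A)=\bigcup_{i=1}^{(q+1)/2}\mathcal C_i^{\mathrm{aff}}$, and the sets in this union are pairwise disjoint. 3.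 If $\mathcal C_1$ is an ellipse, then $d_2=0$, the set $\mathcal C_2^{\mathrm{aff}}$ consists only of the centre, i.e. the point $z$ with $\rho z+\tau=c$, $|\mathcal C_i^{\mathrm{aff}}|=q+1$ for all $i\neq2$, and $|W(A)|=(q^2+1)/2$. 4. If $\mathcal C_1$ is a hyperbola, then $|\mathcal C_i^{\mathrm{aff}}|=q-1$ for all $i$, and $|W(A)|=(q^2-1)/2$. -/

import Mathlib

namespace FFNR

noncomputable section

/-! In this file `K` plays the role of `𝔽_{q²}`, `k` that of `𝔽_q`, and `β ∈ K` is a square root of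
a nonsquare `α ∈ k`, so that every `z ∈ K` is `x + β y` for unique `x, y ∈ k`. -/

/-- The conjugation `x ↦ x ^ q`. -/
def conj {K : Type*} [Field K] (q : ℕ) (x : K) : K := x ^ q

/-- `Re z = (z + conj z) / 2`. -/
def re {K : Type*} [Field K] (q : ℕ) (z : K) : K := (z + conj q z) / 2

/-- `Im z = (z - conj z) / (2 β)`. -/
def im {K : Type*} [Field K] (q : ℕ) (β z : K) : K := (z - conj q z) / (2 * β)

/-- The conjugate transpose `A*`. -/
def conjTrans {K : Type*} [Field K] (q : ℕ) {n : ℕ} (A : Matrix (Fin n) (Fin n) K) :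
    Matrix (Fin n) (Fin n) K :=
  (A.map (conj q)).transpose

/-- The Hermitian form `⟨u, v⟩ = v* u`. -/
def herm {K : Type*} [Field K] (q : ℕ) {n : ℕ} (u v : Fin n → K) : K :=
  ∑ i, conj q (v i) * u i

/-- The numerical range `W(A) = {⟨A v, v⟩ : ⟨v, v⟩ = 1}`. -/
def numericalRange {K : Type*} [Field K] (q : ℕ) {n : ℕ} (A : Matrix (Fin n) (Fin n) K) :
    Set K :=
  {z | ∃ v : Fin n → K, herm q v v = 1 ∧ z = herm q (A.mulVec v) v}

/-- `Re A = (A + A*) / 2`. -/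
def reMat {K : Type*} [Field K] (q : ℕ) {n : ℕ} (A : Matrix (Fin n) (Fin n) K) :
    Matrix (Fin n) (Fin n) K :=
  (2 : K)⁻¹ • (A + conjTrans q A)

/-- `Im A = (A - A*) / (2 β)`. -/
def imMat {K : Type*} [Field K] (q : ℕ) (β : K) {n : ℕ} (A : Matrix (Fin n) (Fin n) K) :
    Matrix (Fin n) (Fin n) K :=
  (2 * β)⁻¹ • (A - conjTrans q A)

/-- The base polynomial `F_A(x : y : t) = det (x Re A + y Im A + t I)`;
the variables `x, y, t` have the indices `0, 1, 2`. -/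
def basePoly {K : Type*} [Field K] (q : ℕ) (β : K) {n : ℕ} (A : Matrix (Fin n) (Fin n) K) :
    MvPolynomial (Fin 3) K :=
  Matrix.det
    ((MvPolynomial.X 0 : MvPolynomial (Fin 3) K) • (reMat q A).map MvPolynomial.C
      + (MvPolynomial.X 1 : MvPolynomial (Fin 3) K) • (imMat q β A).map MvPolynomial.C
      + (MvPolynomial.X 2 : MvPolynomial (Fin 3) K) • (1 : Matrix (Fin n) (Fin n) _))

/-- The zero set in `ℙ²(K)` of a homogeneous polynomial. -/
def zeroSet {K : Type*} [Field K] (F : MvPolynomial (Fin 3) K) :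
    Set (Projectivization K (Fin 3 → K)) :=
  {p | MvPolynomial.eval p.rep F = 0}

/-- The vector of the three partial derivatives of `F` at `w`. -/
def gradient {K : Type*} [Field K] (F : MvPolynomial (Fin 3) K) (w : Fin 3 → K) : Fin 3 → K :=
  fun i => MvPolynomial.eval w (MvPolynomial.pderiv i F)

/-- `F` is nonsingular: no point of its zero set is a zero of all its partial derivatives.
(For quadratic forms the partial derivatives are linear forms over `K`, so that it makes no
difference whether points over `K` or over its algebraic closure are considered.) -/
def IsNonsingular {K : Type*} [Field K] (F : MvPolynomial (Fin 3) K) : Prop :=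
  ∀ p ∈ zeroSet F, gradient F p.rep ≠ 0

/-- The dual curve: the points `(a : b : c)` for which `a x + b y + c t = 0` is the tangent line
to the zero set of `F` at one of its nonsingular points. -/
def dualCurve {K : Type*} [Field K] (F : MvPolynomial (Fin 3) K) :
    Set (Projectivization K (Fin 3 → K)) :=
  {p | ∃ w ∈ zeroSet F, ∃ h : gradient F w.rep ≠ 0, p = Projectivization.mk K _ h}

/-- The boundary generating curve of `A`, as a curve in `ℙ²(K)`. -/
def boundaryCurve {K : Type*} [Field K] (q : ℕ) (β : K) {n : ℕ}
    (A : Matrix (Fin n) (Fin n) K) : Set (Projectivization K (Fin 3 → K)) :=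
  dualCurve (basePoly q β A)

/-- The `k`-affine points `(x : y : 1)`, `x, y ∈ k`, of `S ⊆ ℙ²(K)`, viewed in `K` as
`x + β y`. -/
def affinePoints (k : Type*) {K : Type*} [Field k] [Field K] [Algebra k K] (β : K)
    (S : Set (Projectivization K (Fin 3 → K))) : Set K :=
  {z | ∃ x y : k, z = algebraMap k K x + β * algebraMap k K y ∧
    ∃ h : (![algebraMap k K x, algebraMap k K y, 1] : Fin 3 → K) ≠ 0,
      Projectivization.mk K _ h ∈ S}

/-- The `k`-rational points `(x : y : 0)`, `x, y ∈ k`, of `S ⊆ ℙ²(K)` on the line at infinity. -/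
def infinitePoints (k : Type*) {K : Type*} [Field k] [Field K] [Algebra k K]
    (S : Set (Projectivization K (Fin 3 → K))) : Set (Projectivization K (Fin 3 → K)) :=
  {p | p ∈ S ∧ ∃ x y : k,
    ∃ h : (![algebraMap k K x, algebraMap k K y, 0] : Fin 3 → K) ≠ 0,
      p = Projectivization.mk K _ h}

/-- `S` is a smooth conic that is defined by an equation with coefficients in `k`. -/
def IsSmoothConic (k : Type*) {K : Type*} [Field k] [Field K] [Algebra k K]
    (S : Set (Projectivization K (Fin 3 → K))) : Prop :=
  ∃ Q : MvPolynomial (Fin 3) k, Q.IsHomogeneous 2 ∧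
    IsNonsingular (Q.map (algebraMap k K)) ∧ S = zeroSet (Q.map (algebraMap k K))

/-- An ellipse: a smooth conic over `k` that has no `k`-rational point at infinity. -/
def IsEllipse (k : Type*) {K : Type*} [Field k] [Field K] [Algebra k K]
    (S : Set (Projectivization K (Fin 3 → K))) : Prop :=
  IsSmoothConic k S ∧ infinitePoints k S = ∅

/-- A hyperbola: a smooth conic over `k` that has two `k`-rational points at infinity. -/
def IsHyperbola (k : Type*) {K : Type*} [Field k] [Field K] [Algebra k K]
    (S : Set (Projectivization K (Fin 3 → K))) : Prop :=
  IsSmoothConic k S ∧ (infinitePoints k S).ncard = 2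

/-- The curve `(X - c)² / a - α Y² / b = d` in the coordinates `X, Y` that are obtained from the
coordinates `x, y` by the transformation `z ↦ ρ z + τ` of the plane `K`, that is, by
`X + β Y = ρ (x + β y) + τ`, where `β² = α`. It is homogenized with the third coordinate `t`. -/
def conic {k K : Type*} [Field k] [Field K] [Algebra k K] (q : ℕ) (α : k) (β ρ τ : K)
    (a b c d : k) : Set (Projectivization K (Fin 3 → K)) :=
  {p |
    let x := p.rep 0
    let y := p.rep 1
    let t := p.rep 2
    let X := re q ρ * x + algebraMap k K α * im q β ρ * y + re q τ * t
    let Y := im q β ρ * x + re q ρ * y + im q β τ * t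
    (X - algebraMap k K c * t) ^ 2 / algebraMap k K a
      - algebraMap k K α * (Y ^ 2 / algebraMap k K b) = algebraMap k K d * t ^ 2}

end

end FFNR

/-!
Scaling the anisotropic eigenvector to length one and completing it to an orthonormal basis reduces
`A` to a triangular matrix with diagonal `mid ± δ` and off-diagonal entry `s`
(`exists_unitary_triangular`). A unitary change of basis alters neither the numerical range nor the
base polynomial, so that everything can be computed for the triangular matrix.

Put `N z = conj z * z`. For `⟨v, v⟩ = 1` the value `⟨A v, v⟩` is `mid + r δ + s m` with
`r = N v₀ - N v₁` and `m = conj v₀ * v₁`, and the pairs `(r, m)` that occur are those with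
`4 N m = 1 - r²`, because the norm `K → k` is onto. Choose `ρ ≠ 0` with `ρ δ = e ∈ {0, 1}`, and let
`X + β Y = ρ (z - mid)` and `b = N (ρ s) / 4`, `a = e + b`. The numerical range becomes the set of
`(X, Y)` such that `(X - e r)² - α Y² = b (1 - r²)` for some `r ∈ k`. This equation is quadratic
in `r`, and it is solvable exactly if `X² / a - α Y² / b = 1 - g² / (a b)` for some `g ∈ k`
(`exists_sub_sq_iff`). Hence the numerical range is a union of conics of one pencil, one for each of
the `(q + 1) / 2` values `d = 1 - g² / (a b)`.

The base polynomial is a ternary quadratic form. If it is nonsingular, its gradient is a linear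
bijection, which forces `a b ≠ 0` and carries the form to a multiple of `X² / a - α Y² / b - t²`
(`dualCurve_triangularForm`). So the boundary generating curve is the conic with `d = 1`, that
is, `g = 0`.

Finally, `X² / a - α Y² / b` is anisotropic if and only if `a b` is a square, and this is also the
condition for `d = 0` to occur. In this case the conics are ellipses, and a conic with `d ≠ 0` has
`q + 1` affine points, the elements of a fixed norm in `K` (`ncard_anisotropic`); otherwise they are
hyperbolas `u v = const` with `q - 1` affine points (`ncard_isotropic`).
-/

namespace FFNR

open Module

/-! ### The quadratic extension and its conjugation -/

/-- `K` is the quadratic extension of the finite field `k` with `q` elements, `q` odd, and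
`β ∈ K` is a square root of the nonsquare `α ∈ k`. -/
structure QuadraticExt (k K : Type*) [Field k] [Finite k] [Field K] [Algebra k K]
    (q : ℕ) (α : k) (β : K) : Prop where
  finrank_eq : finrank k K = 2
  card_eq : Nat.card k = q
  odd : Odd q
  not_isSquare : ¬ IsSquare α
  sq_eq : β ^ 2 = algebraMap k K α

theorem ringChar_ne_two_of_odd_card {k : Type*} [Field k] [Finite k]
    (h : Odd (Nat.card k)) : ringChar k ≠ 2 := by
  have := Fintype.ofFinite k
  rw [Ne, FiniteField.even_card_iff_char_two, ← Nat.card_eq_fintype_card]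
  have := Nat.odd_iff.mp h
  omega

theorem isSquare_mul_of_not_isSquare {k : Type*} [Field k] [Finite k] {x y : k}
    (hx : ¬ IsSquare x) (hy : ¬ IsSquare y) : IsSquare (x * y) := by
  have := Fintype.ofFinite k
  have h2 : ringChar k ≠ 2 := fun h => hx (FiniteField.isSquare_of_char_two h x)
  have hx0 : x ≠ 0 := by rintro rfl; exact hx IsSquare.zero
  have hy0 : y ≠ 0 := by rintro rfl; exact hy IsSquare.zero
  rw [FiniteField.isSquare_iff h2 hx0] at hx
  rw [FiniteField.isSquare_iff h2 hy0] at hy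
  rw [FiniteField.isSquare_iff h2 (mul_ne_zero hx0 hy0), mul_pow,
    (FiniteField.pow_dichotomy h2 hx0).resolve_left hx,
    (FiniteField.pow_dichotomy h2 hy0).resolve_left hy]
  norm_num

namespace QuadraticExt

variable {k K : Type*} [Field k] [Finite k] [Field K] [Algebra k K] {q : ℕ} {α : k} {β : K}

theorem two_ne_zero (h : QuadraticExt k K q α β) : (2 : k) ≠ 0 :=
  Ring.two_ne_zero (ringChar_ne_two_of_odd_card (h.card_eq ▸ h.odd))

theorem two_ne_zero' (h : QuadraticExt k K q α β) : (2 : K) ≠ 0 := by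
  have := (map_ne_zero (algebraMap k K)).mpr h.two_ne_zero
  rwa [map_ofNat] at this

theorem α_ne_zero (h : QuadraticExt k K q α β) : α ≠ 0 := by
  rintro rfl
  exact h.not_isSquare IsSquare.zero

theorem β_ne_zero (h : QuadraticExt k K q α β) : β ≠ 0 := by
  rintro rfl
  have := h.sq_eq
  rw [zero_pow (by norm_num), eq_comm, map_eq_zero] at this
  exact h.α_ne_zero this

theorem three_le (h : QuadraticExt k K q α β) : 3 ≤ q := by
  have h1 : 1 < q := h.card_eq ▸ Finite.one_lt_card
  obtain ⟨m, rfl⟩ := h.odd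
  omega

/-- The conjugation is `k`-linear and multiplicative, because it is the Frobenius of `k`. -/
theorem conj_eq_algHom (h : QuadraticExt k K q α β) :
    ∃ φ : K →ₐ[k] K, ∀ z, conj q z = φ z := by
  have := Fintype.ofFinite k
  refine ⟨FiniteField.frobeniusAlgHom k K, fun z => ?_⟩
  rw [FiniteField.coe_frobeniusAlgHom, ← Nat.card_eq_fintype_card, h.card_eq]
  rfl

theorem conj_algebraMap (h : QuadraticExt k K q α β) (x : k) :
    conj q (algebraMap k K x) = algebraMap k K x := by
  obtain ⟨φ, hφ⟩ := h.conj_eq_algHom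
  rw [hφ, φ.commutes]

theorem conj_add (h : QuadraticExt k K q α β) (x y : K) :
    conj q (x + y) = conj q x + conj q y := by
  obtain ⟨φ, hφ⟩ := h.conj_eq_algHom
  simp [hφ]

theorem conj_sub (h : QuadraticExt k K q α β) (x y : K) :
    conj q (x - y) = conj q x - conj q y := by
  obtain ⟨φ, hφ⟩ := h.conj_eq_algHom
  simp [hφ]

theorem conj_neg (h : QuadraticExt k K q α β) (x : K) : conj q (-x) = -conj q x := by
  obtain ⟨φ, hφ⟩ := h.conj_eq_algHom
  simp [hφ]

theorem conj_mul (q : ℕ) (x y : K) : conj q (x * y) = conj q x * conj q y :=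
  mul_pow x y q

theorem conj_zero (h : QuadraticExt k K q α β) : conj q (0 : K) = 0 := by
  obtain ⟨φ, hφ⟩ := h.conj_eq_algHom
  simp [hφ]

/-- Euler's criterion for the nonsquare `α` gives `β ^ q = -β`. -/
theorem conj_β (h : QuadraticExt k K q α β) : conj q β = -β := by
  have := Fintype.ofFinite k
  have h2 : ringChar k ≠ 2 := ringChar_ne_two_of_odd_card (h.card_eq ▸ h.odd)
  have hc : Fintype.card k = q := by rw [← Nat.card_eq_fintype_card, h.card_eq]
  have hn := h.not_isSquare
  rw [FiniteField.isSquare_iff h2 h.α_ne_zero] at hn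
  have h1 := (FiniteField.pow_dichotomy h2 h.α_ne_zero).resolve_left hn
  obtain ⟨m, hm⟩ := h.odd
  rw [hc, show q / 2 = m by omega] at h1
  rw [conj, hm, pow_succ, pow_mul, h.sq_eq, ← map_pow, h1]
  simp

theorem ext_coords (h : QuadraticExt k K q α β) {x y x' y' : k}
    (e : algebraMap k K x + β * algebraMap k K y = algebraMap k K x' + β * algebraMap k K y') :
    x = x' ∧ y = y' := by
  have hy : y = y' := by
    by_contra hne
    have hy : algebraMap k K (y - y') ≠ 0 := (map_ne_zero _).mpr (sub_ne_zero.mpr hne)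
    refine h.not_isSquare ⟨(x' - x) / (y - y'), (algebraMap k K).injective ?_⟩
    rw [← h.sq_eq, map_mul, map_div₀, ← pow_two, div_pow, eq_div_iff (pow_ne_zero 2 hy), ← mul_pow]
    congr 1
    rw [map_sub, map_sub]
    linear_combination e
  refine ⟨(algebraMap k K).injective ?_, hy⟩
  rw [hy] at e
  exact add_right_cancel e

theorem card_K (h : QuadraticExt k K q α β) : Nat.card K = q ^ 2 := by
  have : Module.Finite k K := Module.finite_of_finrank_eq_succ h.finrank_eq
  rw [Module.natCard_eq_pow_finrank (K := k), h.finrank_eq, h.card_eq]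

theorem finite_K (h : QuadraticExt k K q α β) : Finite K := by
  have : Module.Finite k K := Module.finite_of_finrank_eq_succ h.finrank_eq
  exact Module.finite_of_finite k

/-- Every `z ∈ K` is `x + β y` for some `x, y ∈ k`: the map `(x, y) ↦ x + β y` is injective between
sets with `q²` elements. -/
theorem exists_coords (h : QuadraticExt k K q α β) (z : K) :
    ∃ x y : k, z = algebraMap k K x + β * algebraMap k K y := by
  have := h.finite_K
  have hb : Function.Bijective
      (fun p : k × k => algebraMap k K p.1 + β * algebraMap k K p.2) := by
    refine (Nat.bijective_iff_injective_and_card _).mpr ⟨fun p p' e => ?_, ?_⟩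
    · obtain ⟨e1, e2⟩ := h.ext_coords e
      exact Prod.ext e1 e2
    · rw [Nat.card_prod, h.card_eq, h.card_K, pow_two]
  obtain ⟨p, hp⟩ := hb.2 z
  exact ⟨p.1, p.2, hp.symm⟩

theorem conj_coords (h : QuadraticExt k K q α β) (x y : k) :
    conj q (algebraMap k K x + β * algebraMap k K y)
      = algebraMap k K x - β * algebraMap k K y := by
  rw [h.conj_add, conj_mul, h.conj_β, h.conj_algebraMap, h.conj_algebraMap]
  ring

theorem conj_conj (h : QuadraticExt k K q α β) (z : K) : conj q (conj q z) = z := by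
  obtain ⟨x, y, rfl⟩ := h.exists_coords z
  rw [h.conj_coords, h.conj_sub, conj_mul, h.conj_β, h.conj_algebraMap, h.conj_algebraMap]
  ring

theorem re_coords (h : QuadraticExt k K q α β) (x y : k) :
    re q (algebraMap k K x + β * algebraMap k K y) = algebraMap k K x := by
  have := h.two_ne_zero'
  rw [re, h.conj_coords]
  field_simp
  ring

theorem im_coords (h : QuadraticExt k K q α β) (x y : k) :
    im q β (algebraMap k K x + β * algebraMap k K y) = algebraMap k K y := by
  have := h.two_ne_zero'
  have := h.β_ne_zero
  rw [im, h.conj_coords]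
  field_simp
  ring

theorem conj_mul_self_coords (h : QuadraticExt k K q α β) (x y : k) :
    conj q (algebraMap k K x + β * algebraMap k K y)
        * (algebraMap k K x + β * algebraMap k K y)
      = algebraMap k K (x ^ 2 - α * y ^ 2) := by
  rw [h.conj_coords, map_sub, map_mul, map_pow, map_pow, ← h.sq_eq]
  ring

theorem conj_ne_zero (q : ℕ) {z : K} (hz : z ≠ 0) : conj q z ≠ 0 :=
  pow_ne_zero q hz

/-- The norm of a nonzero element is nonzero. -/
theorem sub_mul_sq_ne_zero (h : QuadraticExt k K q α β) {x y : k}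
    (hz : algebraMap k K x + β * algebraMap k K y ≠ 0) : x ^ 2 - α * y ^ 2 ≠ 0 := by
  intro e
  have := h.conj_mul_self_coords x y
  rw [e, map_zero] at this
  exact mul_ne_zero (conj_ne_zero q hz) hz this

theorem exists_conj_mul_self (h : QuadraticExt k K q α β) (c : k) :
    ∃ z : K, conj q z * z = algebraMap k K c := by
  have := Fintype.ofFinite k
  have hc : Fintype.card k % 2 = 1 := by
    rw [← Nat.card_eq_fintype_card, h.card_eq]
    exact Nat.odd_iff.mp h.odd
  obtain ⟨x, y, hxy⟩ := FiniteField.exists_root_sum_quadratic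
    (f := Polynomial.C 1 * Polynomial.X ^ 2 + Polynomial.C 0 * Polynomial.X + Polynomial.C (-c))
    (g := Polynomial.C (-α) * Polynomial.X ^ 2 + Polynomial.C 0 * Polynomial.X + Polynomial.C 0)
    (Polynomial.degree_quadratic one_ne_zero)
    (Polynomial.degree_quadratic (neg_ne_zero.mpr h.α_ne_zero)) hc
  refine ⟨algebraMap k K x + β * algebraMap k K y, ?_⟩
  rw [h.conj_mul_self_coords]
  congr 1
  simp at hxy
  linear_combination hxy

end QuadraticExt

/-! ### Counting points of conics over a finite field -/

namespace QuadraticExt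

variable {k K : Type*} [Field k] [Finite k] [Field K] [Algebra k K] {q : ℕ} {α : k} {β : K}

theorem ncard_pow_eq (h : QuadraticExt k K q α β) {c : k} (hc : c ≠ 0) :
    {z : K | z ^ (q + 1) = algebraMap k K c}.ncard = q + 1 := by
  classical
  have := h.finite_K
  obtain ⟨g, hg⟩ := IsCyclic.exists_ofOrder_eq_natCard (α := Kˣ)
  have hg' : IsPrimitiveRoot g (q ^ 2 - 1) := by
    rw [← h.card_K, ← Nat.card_units, ← hg]
    exact IsPrimitiveRoot.orderOf g
  have h3 := h.three_le
  have hfac : q ^ 2 - 1 = (q - 1) * (q + 1) := by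
    obtain ⟨m, rfl⟩ : ∃ m, q = m + 1 := ⟨q - 1, by omega⟩
    rw [Nat.add_sub_cancel]
    exact Nat.sub_eq_of_eq_add (by ring)
  have hp : 0 < q ^ 2 - 1 := by rw [hfac]; exact Nat.mul_pos (by omega) (by omega)
  have hζ : IsPrimitiveRoot ((g ^ (q - 1) : Kˣ) : K) (q + 1) :=
    IsPrimitiveRoot.coe_units_iff.mpr (hg'.pow hp hfac)
  obtain ⟨z, hz⟩ := h.exists_conj_mul_self c
  have hz' : z ^ (q + 1) = algebraMap k K c := by rw [← hz, conj, pow_succ]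
  have hc' : algebraMap k K c ≠ 0 := (map_ne_zero _).mpr hc
  have hcard := hζ.card_nthRoots (algebraMap k K c)
  rw [if_pos ⟨z, hz'⟩] at hcard
  have hset : {z : K | z ^ (q + 1) = algebraMap k K c}
      = ((Polynomial.nthRoots (q + 1) (algebraMap k K c)).toFinset : Set K) := by
    ext w
    simp [Polynomial.mem_nthRoots (Nat.succ_pos q)]
  rw [hset, Set.ncard_coe_finset, Multiset.toFinset_card_of_nodup, hcard]
  exact hζ.nthRoots_nodup hc'

/-- The conic `x² - γ y² = e`, `e ≠ 0`, with `γ = α g²` a nonsquare has `q + 1` affine points: after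
`y ↦ g y` they are the elements of `K` of norm `e`. -/
theorem ncard_anisotropic (h : QuadraticExt k K q α β) {g e : k} (hg : g ≠ 0) (he : e ≠ 0) :
    {p : k × k | p.1 ^ 2 - α * g ^ 2 * p.2 ^ 2 = e}.ncard = q + 1 := by
  rw [← h.ncard_pow_eq he]
  refine Set.ncard_congr
    (fun p _ => algebraMap k K p.1 + β * algebraMap k K (g * p.2)) ?_ ?_ ?_
  · intro p hp
    change _ ^ (q + 1) = _
    rw [pow_succ]
    refine (h.conj_mul_self_coords _ _).trans ?_
    congr 1
    rw [← (hp : _ = e)]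
    ring
  · intro p p' _ _ e
    obtain ⟨e1, e2⟩ := h.ext_coords e
    exact Prod.ext e1 (mul_left_cancel₀ hg e2)
  · intro z hz
    obtain ⟨x, y, rfl⟩ := h.exists_coords z
    refine ⟨(x, y / g), ?_, ?_⟩
    · have hz' := hz
      change _ ^ (q + 1) = _ at hz'
      rw [pow_succ] at hz'
      have := (algebraMap k K).injective ((h.conj_mul_self_coords x y).symm.trans hz')
      change x ^ 2 - α * g ^ 2 * (y / g) ^ 2 = e
      rw [← this]
      field_simp
    · simp only
      rw [mul_div_cancel₀ _ hg]

end QuadraticExt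

/-- The conic `x² - g² y² = e`, `e ≠ 0`, has `q - 1` affine points: it is `u v = e` for
`u = x + g y`, `v = x - g y`. -/
theorem ncard_isotropic {k : Type*} [Field k] [Finite k] (h2 : (2 : k) ≠ 0)
    {g e : k} (hg : g ≠ 0) (he : e ≠ 0) :
    {p : k × k | p.1 ^ 2 - g ^ 2 * p.2 ^ 2 = e}.ncard = Nat.card k - 1 := by
  have hcard : ({0}ᶜ : Set k).ncard = Nat.card k - 1 := by
    rw [Set.ncard_compl, Set.ncard_singleton]
  rw [← hcard]
  refine Set.ncard_congr (fun p _ => p.1 + g * p.2) ?_ ?_ ?_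
  · intro p hp h0
    refine he ?_
    rw [← (hp : _ = e)]
    have h0' : p.1 + g * p.2 = 0 := h0
    linear_combination (p.1 - g * p.2) * h0'
  · intro p p' hp hp' e1
    simp only [Set.mem_ofPred_eq] at hp hp' e1
    have hne : p.1 + g * p.2 ≠ 0 := by
      intro h0
      refine he ?_
      linear_combination (p.1 - g * p.2) * h0 - hp
    have e2 : p.1 - g * p.2 = p'.1 - g * p'.2 := by
      refine mul_left_cancel₀ hne ?_
      linear_combination hp - hp' - (p'.1 - g * p'.2) * e1
    refine Prod.ext (mul_left_cancel₀ h2 ?_) (mul_left_cancel₀ (mul_ne_zero h2 hg) ?_)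
    · linear_combination e1 + e2
    · linear_combination e1 - e2
  · intro u hu
    have hu' : u ≠ 0 := hu
    refine ⟨((u + e / u) / 2, (u - e / u) / (2 * g)), ?_, ?_⟩
    · simp only [Set.mem_ofPred_eq]
      field_simp
      ring
    · simp only
      field_simp
      ring

/-- There are `(q + 1) / 2` values `1 - g² / c` with `g ∈ k`, since `g` and `-g` give the same value. -/
theorem ncard_one_sub_sq_div {k : Type*} [Field k] [Finite k] (hodd : Odd (Nat.card k))
    {c : k} (hc : c ≠ 0) :
    (Set.range fun g : k => 1 - g ^ 2 / c).ncard = (Nat.card k + 1) / 2 := by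
  classical
  have := Fintype.ofFinite k
  have h2 : (2 : k) ≠ 0 := Ring.two_ne_zero (ringChar_ne_two_of_odd_card hodd)
  set f : k → k := fun g => 1 - g ^ 2 / c with hf
  have hff : ∀ x y, f x = f y ↔ x = y ∨ x = -y := by
    intro x y
    rw [← sq_eq_sq_iff_eq_or_eq_neg]
    simp only [hf, sub_right_inj]
    exact div_left_inj' hc
  have hfib : ∀ g ∈ (Finset.univ : Finset k).erase 0,
      ((Finset.univ.erase 0).filter (fun x => f x = f g)).card = 2 := by
    intro g hg
    have hg0 := Finset.ne_of_mem_erase hg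
    have hne : g ≠ -g := by
      intro e
      exact mul_ne_zero h2 hg0 (by linear_combination e)
    rw [← Finset.card_pair hne]
    congr 1
    ext x
    simp only [Finset.mem_filter, Finset.mem_erase, Finset.mem_univ, and_true, hff,
      Finset.mem_insert, Finset.mem_singleton]
    constructor
    · exact fun h => h.2
    · rintro (rfl | rfl)
      · exact ⟨hg0, Or.inl rfl⟩
      · exact ⟨neg_ne_zero.mpr hg0, Or.inr rfl⟩
  have hsum := Finset.card_eq_sum_card_image f ((Finset.univ : Finset k).erase 0)
  rw [Finset.sum_const_nat (m := 2), Finset.card_erase_of_mem (Finset.mem_univ _),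
    Finset.card_univ, ← Nat.card_eq_fintype_card] at hsum
  · have hr : Set.range f = insert (f 0) (((Finset.univ.erase (0 : k)).image f : Finset k) : Set k) := by
      ext y
      simp only [Set.mem_range, Set.mem_insert_iff, Finset.coe_image, Set.mem_image,
        Finset.coe_erase, Finset.coe_univ]
      constructor
      · rintro ⟨x, rfl⟩
        by_cases hx : x = 0
        · exact Or.inl (by rw [hx])
        · exact Or.inr ⟨x, ⟨trivial, hx⟩, rfl⟩
      · rintro (rfl | ⟨x, -, rfl⟩)
        · exact ⟨0, rfl⟩
        · exact ⟨x, rfl⟩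
    rw [hr, Set.ncard_insert_of_notMem, Set.ncard_coe_finset]
    · have h1 : 1 < Nat.card k := Finite.one_lt_card
      omega
    · intro hmem
      obtain ⟨x, hx, e⟩ := Finset.mem_image.mp (Finset.mem_coe.mp hmem)
      have := (hff _ _).mp e
      simp at this
      exact Finset.ne_of_mem_erase hx this
  · intro y hy
    obtain ⟨g, hg, rfl⟩ := Finset.mem_image.mp hy
    exact hfib g hg

/-- A finite set can be enumerated with two prescribed first elements. -/
theorem exists_enumeration {ι : Type*} {S : Set ι} (hS : S.Finite) {x₁ x₂ : ι}
    (h₁ : x₁ ∈ S) (h₂ : x₂ ∈ S) (hne : x₁ ≠ x₂) :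
    ∃ d : ℕ → ι, Set.BijOn d (Set.Icc 1 S.ncard) S ∧ d 1 = x₁ ∧ d 2 = x₂ := by
  classical
  have hcard : 2 ≤ S.ncard := by
    rw [← Set.ncard_pair hne]
    exact Set.ncard_le_ncard (by rintro _ (rfl | rfl) <;> assumption) hS
  obtain ⟨d, hd⟩ : ∃ d : ℕ → ι, Set.BijOn d (Set.Icc 1 S.ncard) S := by
    have : Nonempty ι := ⟨x₁⟩
    refine (Set.finite_Icc 1 S.ncard).exists_bijOn_of_encard_eq ?_
    rw [← hS.cast_ncard_eq, ← (Set.finite_Icc 1 S.ncard).cast_ncard_eq]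
    simp [Set.ncard_eq_toFinset_card']
  -- two transpositions of `S` move the values at `1` and `2` to `x₁` and `x₂`
  have hswap : ∀ (f : ℕ → ι), Set.BijOn f (Set.Icc 1 S.ncard) S → ∀ x ∈ S, ∀ y ∈ S,
      Set.BijOn (Equiv.swap x y ∘ f) (Set.Icc 1 S.ncard) S := by
    intro f hf x hx y hy
    have hmaps : Set.MapsTo (Equiv.swap x y) S S := by
      intro z hz
      rw [Equiv.swap_apply_def]
      split_ifs <;> assumption
    refine Set.BijOn.comp ⟨hmaps, (Equiv.swap x y).injective.injOn, fun z hz => ?_⟩ hf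
    exact ⟨Equiv.swap x y z, hmaps hz, Equiv.swap_apply_self x y z⟩
  have m1 : 1 ∈ Set.Icc 1 S.ncard := ⟨le_rfl, by omega⟩
  have m2 : 2 ∈ Set.Icc 1 S.ncard := ⟨by omega, hcard⟩
  set d' := Equiv.swap (d 1) x₁ ∘ d with hd'
  have b' := hswap d hd _ (hd.mapsTo m1) _ h₁
  have e1 : d' 1 = x₁ := by simp [hd']
  refine ⟨Equiv.swap (d' 2) x₂ ∘ d', hswap d' b' _ (b'.mapsTo m2) _ h₂, ?_, by simp⟩
  rw [Function.comp_apply, e1]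
  refine Equiv.swap_apply_of_ne_of_ne ?_ hne
  intro e
  have := b'.injOn m1 m2 (e1.trans e)
  omega

/-! ### Unitary reduction to triangular form -/

namespace QuadraticExt

variable {k K : Type*} [Field k] [Finite k] [Field K] [Algebra k K] {q : ℕ} {α : k} {β : K}

theorem herm_mulVec (h : QuadraticExt k K q α β) (M : Matrix (Fin 2) (Fin 2) K)
    (x y : Fin 2 → K) :
    herm q (M.mulVec x) y = herm q x ((conjTrans q M).mulVec y) := by
  simp only [herm, conjTrans, Matrix.mulVec, dotProduct, Fin.sum_univ_two, Matrix.transpose_apply,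
    Matrix.map_apply, h.conj_add, conj_mul, h.conj_conj]
  ring

theorem conjTrans_mul (h : QuadraticExt k K q α β) (M N : Matrix (Fin 2) (Fin 2) K) :
    conjTrans q (M * N) = conjTrans q N * conjTrans q M := by
  ext i j
  simp only [conjTrans, Matrix.mul_apply, Fin.sum_univ_two, Matrix.transpose_apply,
    Matrix.map_apply, h.conj_add, conj_mul]
  ring

theorem conjTrans_conjTrans (h : QuadraticExt k K q α β) (M : Matrix (Fin 2) (Fin 2) K) :
    conjTrans q (conjTrans q M) = M := by
  ext i j
  simp only [conjTrans, Matrix.transpose_apply, Matrix.map_apply, h.conj_conj]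

theorem numericalRange_unitary_conj (h : QuadraticExt k K q α β)
    {U : Matrix (Fin 2) (Fin 2) K} (hU : conjTrans q U * U = 1) (hU' : U * conjTrans q U = 1)
    (B : Matrix (Fin 2) (Fin 2) K) :
    numericalRange q (U * B * conjTrans q U) = numericalRange q B := by
  ext z
  constructor
  · rintro ⟨v, hv, rfl⟩
    refine ⟨(conjTrans q U).mulVec v, ?_, ?_⟩
    · rw [h.herm_mulVec, h.conjTrans_conjTrans, Matrix.mulVec_mulVec, hU', Matrix.one_mulVec, hv]
    · rw [← Matrix.mulVec_mulVec, ← Matrix.mulVec_mulVec, h.herm_mulVec U]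
  · rintro ⟨v, hv, rfl⟩
    refine ⟨U.mulVec v, ?_, ?_⟩
    · rw [h.herm_mulVec, Matrix.mulVec_mulVec, hU, Matrix.one_mulVec, hv]
    · rw [Matrix.mulVec_mulVec, mul_assoc, hU, mul_one, ← Matrix.mulVec_mulVec, h.herm_mulVec U,
        Matrix.mulVec_mulVec, hU, Matrix.one_mulVec]

theorem basePoly_unitary_conj (h : QuadraticExt k K q α β)
    {U : Matrix (Fin 2) (Fin 2) K} (hU' : U * conjTrans q U = 1)
    (B : Matrix (Fin 2) (Fin 2) K) :
    basePoly q β (U * B * conjTrans q U) = basePoly q β B := by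
  have hre : reMat q (U * B * conjTrans q U) = U * reMat q B * conjTrans q U := by
    rw [reMat, reMat, h.conjTrans_mul, h.conjTrans_mul, h.conjTrans_conjTrans, Matrix.mul_smul,
      Matrix.smul_mul, Matrix.mul_add, Matrix.add_mul, Matrix.mul_assoc U (conjTrans q B)]
  have him : imMat q β (U * B * conjTrans q U) = U * imMat q β B * conjTrans q U := by
    rw [imMat, imMat, h.conjTrans_mul, h.conjTrans_mul, h.conjTrans_conjTrans, Matrix.mul_smul,
      Matrix.smul_mul, Matrix.mul_sub, Matrix.sub_mul, Matrix.mul_assoc U (conjTrans q B)]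
  have hone : U.map (MvPolynomial.C : K →+* MvPolynomial (Fin 3) K)
      * (conjTrans q U).map (MvPolynomial.C : K →+* MvPolynomial (Fin 3) K) = 1 := by
    rw [← Matrix.map_mul, hU', Matrix.map_one _ (map_zero _) (map_one _)]
  have hdet : (U.map (MvPolynomial.C : K →+* MvPolynomial (Fin 3) K)).det
      * ((conjTrans q U).map (MvPolynomial.C : K →+* MvPolynomial (Fin 3) K)).det = 1 := by
    rw [← Matrix.det_mul, hone, Matrix.det_one]
  rw [basePoly, basePoly, hre, him]
  rw [Matrix.map_mul, Matrix.map_mul, Matrix.map_mul, Matrix.map_mul]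
  generalize U.map (MvPolynomial.C : K →+* MvPolynomial (Fin 3) K) = V at *
  generalize (conjTrans q U).map (MvPolynomial.C : K →+* MvPolynomial (Fin 3) K) = V' at *
  generalize (reMat q B).map (MvPolynomial.C : K →+* MvPolynomial (Fin 3) K) = R
  generalize (imMat q β B).map (MvPolynomial.C : K →+* MvPolynomial (Fin 3) K) = I
  have : (MvPolynomial.X 0 : MvPolynomial (Fin 3) K) • (V * R * V')
      + (MvPolynomial.X 1 : MvPolynomial (Fin 3) K) • (V * I * V')
      + (MvPolynomial.X 2 : MvPolynomial (Fin 3) K) • (1 : Matrix (Fin 2) (Fin 2) _)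
      = V * ((MvPolynomial.X 0 : MvPolynomial (Fin 3) K) • R
        + (MvPolynomial.X 1 : MvPolynomial (Fin 3) K) • I
        + (MvPolynomial.X 2 : MvPolynomial (Fin 3) K) • (1 : Matrix (Fin 2) (Fin 2) _)) * V' := by
    rw [← hone]
    simp only [Matrix.mul_add, Matrix.add_mul, Matrix.mul_smul, Matrix.smul_mul]
    rw [hone, Matrix.mul_one, hone]
  rw [this, Matrix.det_mul, Matrix.det_mul, mul_right_comm, hdet, one_mul]

/-- A `2 × 2` matrix with an anisotropic eigenvector `u` is unitarily similar to an upper triangular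
matrix: since the norm of `K` over `k` is onto, `u` can be scaled to `⟨u, u⟩ = 1`, and then
`(-conj u₁, conj u₀)` completes it to an orthonormal basis. -/
theorem exists_unitary_triangular (h : QuadraticExt k K q α β)
    {A : Matrix (Fin 2) (Fin 2) K} {μ : K} {u : Fin 2 → K} (hAu : A.mulVec u = μ • u)
    (hu : herm q u u ≠ 0) :
    ∃ (U : Matrix (Fin 2) (Fin 2) K) (s ν : K), conjTrans q U * U = 1 ∧ U * conjTrans q U = 1 ∧
      A = U * !![μ, s; 0, ν] * conjTrans q U := by
  obtain ⟨c, hc⟩ : ∃ c : k, herm q u u = algebraMap k K c := by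
    obtain ⟨x, y, e0⟩ := h.exists_coords (u 0)
    obtain ⟨x', y', e1⟩ := h.exists_coords (u 1)
    refine ⟨(x ^ 2 - α * y ^ 2) + (x' ^ 2 - α * y' ^ 2), ?_⟩
    rw [map_add, ← h.conj_mul_self_coords, ← h.conj_mul_self_coords, ← e0, ← e1, herm,
      Fin.sum_univ_two]
  have hc0 : algebraMap k K c ≠ 0 := hc ▸ hu
  obtain ⟨z, hz⟩ := h.exists_conj_mul_self c⁻¹
  set p := z * u 0 with hp
  set r := z * u 1 with hr
  have hpr : conj q p * p + conj q r * r = 1 := by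
    have : conj q (u 0) * u 0 + conj q (u 1) * u 1 = algebraMap k K c := by
      rw [← hc, herm, Fin.sum_univ_two]
    rw [hp, hr, conj_mul, conj_mul]
    rw [map_inv₀] at hz
    have hcc := inv_mul_cancel₀ hc0
    linear_combination conj q z * z * this + algebraMap k K c * hz + hcc
  have hA0 : A 0 0 * p + A 0 1 * r = μ * p := by
    have := congrFun hAu 0
    simp only [Matrix.mulVec, dotProduct, Fin.sum_univ_two, Pi.smul_apply, smul_eq_mul] at this
    linear_combination z * this
  have hA1 : A 1 0 * p + A 1 1 * r = μ * r := by
    have := congrFun hAu 1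
    simp only [Matrix.mulVec, dotProduct, Fin.sum_univ_two, Pi.smul_apply, smul_eq_mul] at this
    linear_combination z * this
  set U : Matrix (Fin 2) (Fin 2) K := !![p, -conj q r; r, conj q p] with hUdef
  have hUs : conjTrans q U = !![conj q p, conj q r; -r, p] := by
    ext i j
    fin_cases i <;> fin_cases j <;> simp [conjTrans, hUdef, h.conj_neg, h.conj_conj]
  have hU : conjTrans q U * U = 1 := by
    have e01 : conj q p * -conj q r + conj q r * conj q p = 0 := by ring
    have e10 : -r * p + p * r = 0 := by ring
    have e11 : -r * -conj q r + p * conj q p = 1 := by linear_combination hpr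
    rw [hUs, hUdef, Matrix.mul_fin_two, Matrix.one_fin_two, hpr, e01, e10, e11]
  have hU' : U * conjTrans q U = 1 := mul_eq_one_comm.mp hU
  set B := conjTrans q U * A * U with hB
  have hBA : A = U * B * conjTrans q U := by
    rw [hB, ← mul_assoc, ← mul_assoc, hU', one_mul, mul_assoc, hU', mul_one]
  refine ⟨U, B 0 1, B 1 1, hU, hU', ?_⟩
  have hBe : B = !![μ, B 0 1; 0, B 1 1] := by
    have h00 : B 0 0 = μ := by
      rw [hB, hUs, hUdef]
      simp only [Matrix.mul_apply, Fin.sum_univ_two, Matrix.of_apply, Matrix.cons_val', Matrix.cons_val_zero,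
        Matrix.cons_val_one, Matrix.cons_val_fin_one]
      linear_combination conj q p * hA0 + conj q r * hA1 + μ * hpr
    have h10 : B 1 0 = 0 := by
      rw [hB, hUs, hUdef]
      simp only [Matrix.mul_apply, Fin.sum_univ_two, Matrix.of_apply, Matrix.cons_val', Matrix.cons_val_zero,
        Matrix.cons_val_one, Matrix.cons_val_fin_one]
      linear_combination -r * hA0 + p * hA1
    ext i j
    fin_cases i <;> fin_cases j <;> simp [h00, h10]
  rw [← hBe]
  exact hBA

/-- The numerical range of a triangular matrix: for `⟨v, v⟩ = 1` put `r = N(v₀) - N(v₁)` and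
`m = conj v₀ * v₁`. -/
theorem mem_numericalRange_triangular (h : QuadraticExt k K q α β) {μ ν δ mid s : K}
    (hμ : μ = mid + δ) (hν : ν = mid - δ) (z : K) :
    z ∈ numericalRange q !![μ, s; 0, ν] ↔
      ∃ (r : k) (m : K), 4 * (conj q m * m) = algebraMap k K (1 - r ^ 2) ∧
        z = mid + algebraMap k K r * δ + s * m := by
  have h2 := h.two_ne_zero'
  have h2k := h.two_ne_zero
  subst hμ hν
  constructor
  · rintro ⟨v, hv, rfl⟩
    obtain ⟨x, y, e0⟩ := h.exists_coords (v 0)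
    obtain ⟨x', y', e1⟩ := h.exists_coords (v 1)
    have n0 := h.conj_mul_self_coords x y
    have n1 := h.conj_mul_self_coords x' y'
    rw [← e0] at n0
    rw [← e1] at n1
    rw [herm, Fin.sum_univ_two, n0, n1] at hv
    generalize x ^ 2 - α * y ^ 2 = N0 at *
    generalize x' ^ 2 - α * y' ^ 2 = N1 at *
    refine ⟨N0 - N1, conj q (v 0) * v 1, ?_, ?_⟩
    · rw [conj_mul, h.conj_conj]
      simp only [map_sub, map_one, map_pow]
      linear_combination 4 * conj q (v 1) * v 1 * n0 + 4 * algebraMap k K N0 * n1 +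
        (1 + algebraMap k K N0 + algebraMap k K N1) * hv
    · simp only [herm, Matrix.mulVec, dotProduct, Fin.sum_univ_two, Matrix.of_apply,
        Matrix.cons_val', Matrix.cons_val_zero, Matrix.cons_val_one, Matrix.cons_val_fin_one]
      simp only [map_sub]
      linear_combination (mid + δ) * n0 + (mid - δ) * n1 + mid * hv
  · rintro ⟨r, m, hm, rfl⟩
    obtain ⟨x, hx⟩ := h.exists_conj_mul_self ((1 + r) / 2)
    have hr2 : algebraMap k K ((1 + r) / 2) * 2 = 1 + algebraMap k K r := by
      have := congrArg (algebraMap k K) (div_mul_cancel₀ (1 + r) h2k)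
      rwa [map_mul, map_ofNat, map_add, map_one] at this
    simp only [map_sub, map_one, map_pow] at hm
    obtain ⟨y, hy, hmy⟩ : ∃ y : K, 2 * (conj q y * y) = 1 - algebraMap k K r ∧
        conj q x * y = m := by
      by_cases hx0 : x = 0
      · -- here `r = -1`, so that `m = 0` and `y` is any element of norm `1`
        obtain ⟨y, hy⟩ := h.exists_conj_mul_self 1
        rw [hx0, mul_zero] at hx
        have hr : algebraMap k K r = -1 := by linear_combination -2 * hx - hr2
        have hm0 : conj q m * m = 0 := by
          refine mul_left_cancel₀ (mul_ne_zero h2 h2) ?_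
          rw [hr] at hm
          linear_combination hm
        have hm0 : m = 0 := by
          by_contra hne
          exact mul_ne_zero (conj_ne_zero q hne) hne hm0
        refine ⟨y, ?_, ?_⟩
        · rw [hy, hr, map_one]
          norm_num
        · rw [hx0, h.conj_zero, zero_mul, hm0]
      · have hcx := conj_ne_zero q hx0
        refine ⟨m / conj q x, ?_, mul_div_cancel₀ _ hcx⟩
        have hcm : conj q (m / conj q x) * x = conj q m := by
          have : conj q (m / conj q x) * conj q (conj q x) = conj q m := by
            rw [← conj_mul, div_mul_cancel₀ _ hcx]
          rwa [h.conj_conj] at this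
        have hmm : m / conj q x * conj q x = m := div_mul_cancel₀ _ hcx
        refine mul_left_cancel₀ (mul_ne_zero h2 (mul_ne_zero hcx hx0)) ?_
        linear_combination 4 * (m / conj q x) * conj q x * hcm + 4 * conj q m * hmm + hm -
          2 * (1 - algebraMap k K r) * hx - (1 - algebraMap k K r) * hr2
    refine ⟨![x, y], ?_, ?_⟩
    · rw [herm, Fin.sum_univ_two]
      refine mul_left_cancel₀ h2 ?_
      simp only [Matrix.cons_val_zero, Matrix.cons_val_one, Matrix.cons_val_fin_one]
      linear_combination 2 * hx + hy + hr2
    · simp only [herm, Matrix.mulVec, dotProduct, Fin.sum_univ_two, Matrix.of_apply,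
        Matrix.cons_val', Matrix.cons_val_zero, Matrix.cons_val_one, Matrix.cons_val_fin_one]
      refine mul_left_cancel₀ h2 ?_
      linear_combination (-2 * (mid + δ)) * hx - (mid + δ) * hr2 - (mid - δ) * hy - 2 * s * hmy

end QuadraticExt

/-! ### The base polynomial of a triangular matrix -/

namespace QuadraticExt

variable {k K : Type*} [Field k] [Finite k] [Field K] [Algebra k K] {q : ℕ} {α : k} {β : K}

open MvPolynomial in
theorem basePoly_triangular (h : QuadraticExt k K q α β) {μ ν s : K} {m₁ m₂ δ₁ δ₂ n : k}
    (hμ : μ = algebraMap k K (m₁ + δ₁) + β * algebraMap k K (m₂ + δ₂))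
    (hν : ν = algebraMap k K (m₁ - δ₁) + β * algebraMap k K (m₂ - δ₂))
    (hn : conj q s * s = algebraMap k K (4 * n)) :
    basePoly q β !![μ, s; 0, ν] =
      (X 0 * C (algebraMap k K m₁) + X 1 * C (algebraMap k K m₂) + X 2) ^ 2
      - (X 0 * C (algebraMap k K δ₁) + X 1 * C (algebraMap k K δ₂)) ^ 2
      - C (algebraMap k K n) * (X 0 ^ 2 - C (algebraMap k K α⁻¹) * X 1 ^ 2) := by
  have h2 := h.two_ne_zero'
  have hb := h.β_ne_zero
  have r00 : reMat q !![μ, s; 0, ν] 0 0 = algebraMap k K (m₁ + δ₁) := by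
    rw [← h.re_coords (m₁ + δ₁) (m₂ + δ₂), ← hμ]
    simp [reMat, re, conjTrans]
    ring
  have r11 : reMat q !![μ, s; 0, ν] 1 1 = algebraMap k K (m₁ - δ₁) := by
    rw [← h.re_coords (m₁ - δ₁) (m₂ - δ₂), ← hν]
    simp [reMat, re, conjTrans]
    ring
  have i00 : imMat q β !![μ, s; 0, ν] 0 0 = algebraMap k K (m₂ + δ₂) := by
    rw [← h.im_coords (m₁ + δ₁) (m₂ + δ₂), ← hμ]
    simp [imMat, im, conjTrans]
    ring
  have i11 : imMat q β !![μ, s; 0, ν] 1 1 = algebraMap k K (m₂ - δ₂) := by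
    rw [← h.im_coords (m₁ - δ₁) (m₂ - δ₂), ← hν]
    simp [imMat, im, conjTrans]
    ring
  have r01 : reMat q !![μ, s; 0, ν] 0 1 = s / 2 := by
    simp [reMat, conjTrans, h.conj_zero]
    ring
  have r10 : reMat q !![μ, s; 0, ν] 1 0 = conj q s / 2 := by
    simp [reMat, conjTrans]
    ring
  have i01 : imMat q β !![μ, s; 0, ν] 0 1 = s / 2 * β⁻¹ := by
    simp [imMat, conjTrans, h.conj_zero]
    ring
  have i10 : imMat q β !![μ, s; 0, ν] 1 0 = -(conj q s / 2 * β⁻¹) := by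
    simp [imMat, conjTrans]
    ring
  have e1 : (C (s / 2) : MvPolynomial (Fin 3) K) * C (conj q s / 2) = C (algebraMap k K n) := by
    rw [← C_mul]
    congr 1
    rw [map_mul, map_ofNat] at hn
    field_simp
    linear_combination hn
  have e2 : (C β⁻¹ : MvPolynomial (Fin 3) K) * C β⁻¹ = C (algebraMap k K α⁻¹) := by
    rw [← C_mul, map_inv₀, ← h.sq_eq, pow_two, mul_inv]
  rw [basePoly, Matrix.det_fin_two]
  simp only [Matrix.add_apply, Matrix.smul_apply, Matrix.map_apply, smul_eq_mul, r00, r01, r10,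
    r11, i00, i01, i10, i11, Matrix.one_apply_eq, ne_eq, zero_ne_one, one_ne_zero,
    not_false_eq_true, Matrix.one_apply_ne, map_add, map_sub, map_neg, map_mul, mul_one, mul_zero,
    add_zero]
  linear_combination (-(X 0 ^ 2) + X 1 ^ 2 * C β⁻¹ * C β⁻¹) * e1
    + X 1 ^ 2 * C (algebraMap k K n) * e2

end QuadraticExt

/-! ### Ternary quadratic forms and their dual curves -/

open MvPolynomial

/-- The gradient of a nonsingular quadratic form is a linear bijection: by Euler's identity a vector
with zero gradient would be a singular point. -/
theorem gradient_surjective {K : Type*} [Field K] {F : MvPolynomial (Fin 3) K}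
    (h2 : (2 : K) ≠ 0)
    (hadd : ∀ v w, gradient F (v + w) = gradient F v + gradient F w)
    (hsmul : ∀ (c : K) w, gradient F (c • w) = c • gradient F w)
    (heuler : ∀ w, 2 * eval w F = ∑ i, w i * gradient F w i)
    (hF : IsNonsingular F) : Function.Surjective (gradient F) := by
  let f : (Fin 3 → K) →ₗ[K] (Fin 3 → K) :=
    { toFun := gradient F, map_add' := hadd, map_smul' := hsmul }
  have hinj : Function.Injective f := by
    refine (injective_iff_map_eq_zero f).mpr fun w hw => ?_
    by_contra hne
    obtain ⟨c, hc⟩ := Projectivization.exists_smul_eq_mk_rep K w hne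
    have hrep : gradient F (Projectivization.mk K w hne).rep = 0 := by
      rw [← hc, Units.smul_def, hsmul, show gradient F w = 0 from hw, smul_zero]
    refine hF (Projectivization.mk K w hne) ?_ hrep
    refine mul_left_cancel₀ h2 ?_
    rw [heuler, hrep]
    simp
  exact LinearMap.injective_iff_surjective.mp hinj

/-- If the gradient of `F` is a linear bijection carrying the quadratic form `-4 F` to `Q`, then the
zero set of `Q` is the dual curve of `F`. -/
theorem dualCurve_eq_zeroSet {K : Type*} [Field K] {F Q : MvPolynomial (Fin 3) K}
    (h2 : (2 : K) ≠ 0)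
    (hsmul : ∀ (c : K) w, gradient F (c • w) = c • gradient F w)
    (hFhom : ∀ (c : K) w, eval (c • w) F = c ^ 2 * eval w F)
    (hQhom : ∀ (c : K) w, eval (c • w) Q = c ^ 2 * eval w Q)
    (hQ : ∀ w, eval (gradient F w) Q = -4 * eval w F)
    (hsurj : Function.Surjective (gradient F)) : dualCurve F = zeroSet Q := by
  ext p
  constructor
  · rintro ⟨w, hw, hg, rfl⟩
    obtain ⟨c, hc⟩ := Projectivization.exists_smul_eq_mk_rep K _ hg
    change eval _ Q = 0
    rw [← hc, Units.smul_def, hQhom, hQ, show eval w.rep F = 0 from hw]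
    ring
  · intro hp
    obtain ⟨w, hw⟩ := hsurj p.rep
    have hw0 : w ≠ 0 := by
      rintro rfl
      have := hsmul 0 0
      rw [zero_smul, zero_smul, hw] at this
      exact p.rep_nonzero this
    obtain ⟨c, hc⟩ := Projectivization.exists_smul_eq_mk_rep K _ hw0
    have hgr : gradient F (Projectivization.mk K w hw0).rep = c • p.rep := by
      rw [← hc, Units.smul_def, hsmul, hw, Units.smul_def]
    have hFw : eval w F = 0 := by
      have h := hQ w
      rw [hw, show eval p.rep Q = 0 from hp] at h
      have h4 : (-4 : K) ≠ 0 := by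
        rw [show (-4 : K) = -(2 * 2) by norm_num]
        exact neg_ne_zero.mpr (mul_ne_zero h2 h2)
      exact (mul_eq_zero.mp h.symm).resolve_left h4
    refine ⟨Projectivization.mk K w hw0, ?_, ?_, ?_⟩
    · change eval _ F = 0
      rw [← hc, Units.smul_def, hFhom, hFw, mul_zero]
    · rw [hgr, Units.smul_def]
      exact smul_ne_zero c.ne_zero p.rep_nonzero
    · refine p.mk_rep.symm.trans ?_
      rw [Projectivization.mk_eq_mk_iff]
      exact ⟨c⁻¹, by rw [hgr, inv_smul_smul]⟩

/-- The form `T² - D² - n (x² - α' y²)` with `T = m₁ x + m₂ y + t` and `D = δ₁ x + δ₂ y`. For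
`α' = α⁻¹` it is the base polynomial of a triangular matrix. -/
noncomputable def triangularForm {K : Type*} [Field K] (m₁ m₂ δ₁ δ₂ n α' : K) :
    MvPolynomial (Fin 3) K :=
  (X 0 * C m₁ + X 1 * C m₂ + X 2) ^ 2 - (X 0 * C δ₁ + X 1 * C δ₂) ^ 2
    - C n * (X 0 ^ 2 - C α' * X 1 ^ 2)

theorem eval_triangularForm {K : Type*} [Field K] (m₁ m₂ δ₁ δ₂ n α' : K) (w : Fin 3 → K) :
    eval w (triangularForm m₁ m₂ δ₁ δ₂ n α') =
      (w 0 * m₁ + w 1 * m₂ + w 2) ^ 2 - (w 0 * δ₁ + w 1 * δ₂) ^ 2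
        - n * (w 0 ^ 2 - α' * w 1 ^ 2) := by
  simp [triangularForm]

theorem gradient_triangularForm {K : Type*} [Field K] (m₁ m₂ δ₁ δ₂ n α' : K) (w : Fin 3 → K) :
    gradient (triangularForm m₁ m₂ δ₁ δ₂ n α') w =
      ![2 * ((w 0 * m₁ + w 1 * m₂ + w 2) * m₁ - (w 0 * δ₁ + w 1 * δ₂) * δ₁ - n * w 0),
        2 * ((w 0 * m₁ + w 1 * m₂ + w 2) * m₂ - (w 0 * δ₁ + w 1 * δ₂) * δ₂ + n * α' * w 1),
        2 * (w 0 * m₁ + w 1 * m₂ + w 2)] := by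
  ext i
  fin_cases i <;>
    simp [gradient, triangularForm, Derivation.leibniz_pow, pderiv_X] <;> ring

/-- The form `X² / a - α Y² / b - d t²` in the coordinates `X = r₁ x + α r₂ y + t₁ t` and
`Y = r₂ x + r₁ y + t₂ t`, that is, `X + β Y = (r₁ + β r₂) (x + β y) + (t₁ + β t₂) t` for `β² = α`. -/
noncomputable def conicForm {K : Type*} [Field K] (α r₁ r₂ t₁ t₂ a b d : K) :
    MvPolynomial (Fin 3) K :=
  C a⁻¹ * (C r₁ * X 0 + C (α * r₂) * X 1 + C t₁ * X 2) ^ 2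
    - C (α * b⁻¹) * (C r₂ * X 0 + C r₁ * X 1 + C t₂ * X 2) ^ 2 - C d * X 2 ^ 2

section

variable {K : Type*} [Field K] (α r₁ r₂ t₁ t₂ a b d : K)

theorem eval_conicForm (w : Fin 3 → K) :
    eval w (conicForm α r₁ r₂ t₁ t₂ a b d) =
      (r₁ * w 0 + α * r₂ * w 1 + t₁ * w 2) ^ 2 / a
        - α * ((r₂ * w 0 + r₁ * w 1 + t₂ * w 2) ^ 2 / b) - d * w 2 ^ 2 := by
  simp [conicForm]
  ring

theorem eval_smul_conicForm (c : K) (w : Fin 3 → K) :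
    eval (c • w) (conicForm α r₁ r₂ t₁ t₂ a b d) =
      c ^ 2 * eval w (conicForm α r₁ r₂ t₁ t₂ a b d) := by
  rw [eval_conicForm, eval_conicForm]
  simp only [Pi.smul_apply, smul_eq_mul]
  ring

theorem map_conicForm {L : Type*} [Field L] (f : K →+* L) :
    (conicForm α r₁ r₂ t₁ t₂ a b d).map f =
      conicForm (f α) (f r₁) (f r₂) (f t₁) (f t₂) (f a) (f b) (f d) := by
  simp [conicForm]

theorem isHomogeneous_conicForm : (conicForm α r₁ r₂ t₁ t₂ a b d).IsHomogeneous 2 := by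
  have hl : ∀ x y z : K, (C x * X 0 + C y * X 1 + C z * X 2 :
      MvPolynomial (Fin 3) K).IsHomogeneous 1 := fun x y z =>
    ((isHomogeneous_C_mul_X _ _).add (isHomogeneous_C_mul_X _ _)).add (isHomogeneous_C_mul_X _ _)
  have hX : (X 2 : MvPolynomial (Fin 3) K).IsHomogeneous 1 := isHomogeneous_X _ _
  exact ((((hl _ _ _).pow 2).C_mul _).sub (((hl _ _ _).pow 2).C_mul _)).sub ((hX.pow 2).C_mul _)

theorem gradient_conicForm (w : Fin 3 → K) :
    gradient (conicForm α r₁ r₂ t₁ t₂ a b d) w =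
      ![2 * (r₁ * ((r₁ * w 0 + α * r₂ * w 1 + t₁ * w 2) / a)
          - r₂ * (α * ((r₂ * w 0 + r₁ * w 1 + t₂ * w 2) / b))),
        2 * (α * r₂ * ((r₁ * w 0 + α * r₂ * w 1 + t₁ * w 2) / a)
          - r₁ * (α * ((r₂ * w 0 + r₁ * w 1 + t₂ * w 2) / b))),
        2 * (t₁ * ((r₁ * w 0 + α * r₂ * w 1 + t₁ * w 2) / a)
          - t₂ * (α * ((r₂ * w 0 + r₁ * w 1 + t₂ * w 2) / b)) - d * w 2)] := by
  ext i
  fin_cases i <;>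
    simp [gradient, conicForm, Derivation.leibniz_pow, pderiv_X] <;> ring

variable {α r₁ r₂ a b d}

theorem coords_eq_zero {x y : K} (hN : r₁ ^ 2 - α * r₂ ^ 2 ≠ 0)
    (hx : r₁ * x + α * r₂ * y = 0) (hy : r₂ * x + r₁ * y = 0) : x = 0 ∧ y = 0 := by
  constructor
  · refine mul_left_cancel₀ hN ?_
    linear_combination r₁ * hx - α * r₂ * hy
  · refine mul_left_cancel₀ hN ?_
    linear_combination r₁ * hy - r₂ * hx

theorem isNonsingular_conicForm (h2 : (2 : K) ≠ 0) (hN : r₁ ^ 2 - α * r₂ ^ 2 ≠ 0)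
    (hα : α ≠ 0) (ha : a ≠ 0) (hb : b ≠ 0) (hd : d ≠ 0) :
    IsNonsingular (conicForm α r₁ r₂ t₁ t₂ a b d) := by
  intro p _ h0
  rw [gradient_conicForm] at h0
  have g0 := mul_left_cancel₀ h2 ((congrFun h0 0).trans (mul_zero 2).symm)
  have g1 := mul_left_cancel₀ h2 ((congrFun h0 1).trans (mul_zero 2).symm)
  have g2 := mul_left_cancel₀ h2 ((congrFun h0 2).trans (mul_zero 2).symm)
  have hX : (r₁ * p.rep 0 + α * r₂ * p.rep 1 + t₁ * p.rep 2) / a = 0 := by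
    refine mul_left_cancel₀ hN ?_
    linear_combination r₁ * g0 - r₂ * g1
  have hY : (r₂ * p.rep 0 + r₁ * p.rep 1 + t₂ * p.rep 2) / b = 0 := by
    refine mul_left_cancel₀ (mul_ne_zero hN hα) ?_
    linear_combination α * r₂ * g0 - r₁ * g1
  rw [hX, hY] at g2
  have ht : p.rep 2 = 0 := by
    refine mul_left_cancel₀ hd ?_
    linear_combination -g2
  rw [ht, mul_zero, add_zero] at hX hY
  obtain ⟨hx, hy⟩ := coords_eq_zero hN ((div_eq_zero_iff.mp hX).resolve_right ha)
    ((div_eq_zero_iff.mp hY).resolve_right hb)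
  refine p.rep_nonzero (funext fun i => ?_)
  fin_cases i
  · exact hx
  · exact hy
  · exact ht

theorem mk_mem_zeroSet_conicForm {w : Fin 3 → K} (hw : w ≠ 0) :
    Projectivization.mk K w hw ∈ zeroSet (conicForm α r₁ r₂ t₁ t₂ a b d) ↔
      eval w (conicForm α r₁ r₂ t₁ t₂ a b d) = 0 := by
  obtain ⟨c, hc⟩ := Projectivization.exists_smul_eq_mk_rep K w hw
  change eval _ _ = 0 ↔ _
  rw [← hc, Units.smul_def, eval_smul_conicForm]
  simp

end

section

variable {K : Type*} [Field K] {m₁ m₂ δ₁ δ₂ n α α' r₁ r₂ e : K}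

/-- In the coordinates `X, Y`, the gradient of the triangular form is `X = -2 a u / N` and
`Y = -2 n α' v` with `N = r₁² - α r₂²`, `a = e + n N`, `u = r₁ x - r₂ y`, `v = α r₂ x - r₁ y`.
The conditions on `δ₁, δ₂` say that `(δ₁ + β δ₂) (r₁ + β r₂) = e`. -/
theorem gradient_triangularForm_coords (hα : α * α' = 1) (hN : r₁ ^ 2 - α * r₂ ^ 2 ≠ 0)
    (he : e ^ 2 = e) (h₁ : (r₁ ^ 2 - α * r₂ ^ 2) * δ₁ = e * r₁)
    (h₂ : (r₁ ^ 2 - α * r₂ ^ 2) * δ₂ = -(e * r₂)) (w : Fin 3 → K) :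
    r₁ * gradient (triangularForm m₁ m₂ δ₁ δ₂ n α') w 0
        + α * r₂ * gradient (triangularForm m₁ m₂ δ₁ δ₂ n α') w 1
        - (r₁ * m₁ + α * r₂ * m₂) * gradient (triangularForm m₁ m₂ δ₁ δ₂ n α') w 2
      = -2 * (e + n * (r₁ ^ 2 - α * r₂ ^ 2)) * ((r₁ * w 0 - r₂ * w 1) / (r₁ ^ 2 - α * r₂ ^ 2)) ∧
    r₂ * gradient (triangularForm m₁ m₂ δ₁ δ₂ n α') w 0
        + r₁ * gradient (triangularForm m₁ m₂ δ₁ δ₂ n α') w 1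
        - (r₁ * m₂ + r₂ * m₁) * gradient (triangularForm m₁ m₂ δ₁ δ₂ n α') w 2
      = -2 * n * α' * (α * r₂ * w 0 - r₁ * w 1) := by
  rw [gradient_triangularForm]
  simp only [Matrix.cons_val_zero, Matrix.cons_val_one, Matrix.cons_val]
  set N := r₁ ^ 2 - α * r₂ ^ 2 with hNdef
  have d1 : δ₁ = e * r₁ / N := by rw [eq_div_iff hN]; linear_combination h₁
  have d2 : δ₂ = -(e * r₂) / N := by rw [eq_div_iff hN]; linear_combination h₂
  have k1 : r₁ * δ₁ + α * r₂ * δ₂ = e := by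
    rw [d1, d2]
    field_simp
    rw [hNdef]
    ring
  have k2 : r₂ * δ₁ + r₁ * δ₂ = 0 := by
    rw [d1, d2]
    field_simp
    ring
  have k3 : w 0 * δ₁ + w 1 * δ₂ = e * ((r₁ * w 0 - r₂ * w 1) / N) := by
    rw [d1, d2]
    field_simp
    ring
  have k4 : N * ((r₁ * w 0 - r₂ * w 1) / N) = r₁ * w 0 - r₂ * w 1 := mul_div_cancel₀ _ hN
  constructor
  · linear_combination -2 * (w 0 * δ₁ + w 1 * δ₂) * k1 - 2 * e * k3
      - 2 * ((r₁ * w 0 - r₂ * w 1) / N) * he + 2 * n * k4 + 2 * n * r₂ * w 1 * hα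
  · linear_combination -2 * (w 0 * δ₁ + w 1 * δ₂) * k2 + 2 * n * r₂ * w 0 * hα

theorem eval_conicForm_gradient (hα : α * α' = 1) (hN : r₁ ^ 2 - α * r₂ ^ 2 ≠ 0)
    (he : e ^ 2 = e) (h₁ : (r₁ ^ 2 - α * r₂ ^ 2) * δ₁ = e * r₁)
    (h₂ : (r₁ ^ 2 - α * r₂ ^ 2) * δ₂ = -(e * r₂)) (hn : n ≠ 0)
    (ha : e + n * (r₁ ^ 2 - α * r₂ ^ 2) ≠ 0) (w : Fin 3 → K) :
    eval (gradient (triangularForm m₁ m₂ δ₁ δ₂ n α') w)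
        (conicForm α r₁ r₂ (-(r₁ * m₁ + α * r₂ * m₂)) (-(r₁ * m₂ + r₂ * m₁))
          (e + n * (r₁ ^ 2 - α * r₂ ^ 2)) (n * (r₁ ^ 2 - α * r₂ ^ 2)) 1)
      = -4 * eval w (triangularForm m₁ m₂ δ₁ δ₂ n α') := by
  obtain ⟨hX, hY⟩ := gradient_triangularForm_coords (m₁ := m₁) (m₂ := m₂) (n := n) hα hN he h₁ h₂ w
  rw [eval_conicForm, eval_triangularForm, neg_mul, neg_mul, ← sub_eq_add_neg, ← sub_eq_add_neg,
    hX, hY, gradient_triangularForm]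
  simp only [Matrix.cons_val]
  set N := r₁ ^ 2 - α * r₂ ^ 2 with hNdef
  have d1 : δ₁ = e * r₁ / N := by rw [eq_div_iff hN]; linear_combination h₁
  have d2 : δ₂ = -(e * r₂) / N := by rw [eq_div_iff hN]; linear_combination h₂
  have k3 : w 0 * δ₁ + w 1 * δ₂ = e * ((r₁ * w 0 - r₂ * w 1) / N) := by
    rw [d1, d2]
    field_simp
    ring
  have k5 : w 0 ^ 2 - α' * w 1 ^ 2
      = ((r₁ * w 0 - r₂ * w 1) ^ 2 - α' * (α * r₂ * w 0 - r₁ * w 1) ^ 2) / N := by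
    rw [eq_div_iff hN, hNdef]
    linear_combination (α * r₂ ^ 2 * w 0 ^ 2 + r₂ ^ 2 * w 1 ^ 2 - 2 * r₁ * r₂ * w 0 * w 1) * hα
  rw [k3, k5]
  generalize r₁ * w 0 - r₂ * w 1 = u
  generalize α * r₂ * w 0 - r₁ * w 1 = v
  field_simp
  linear_combination (-4 * u ^ 2) * he - (4 * n * N * v ^ 2 * α') * hα

/-- The dual of a nonsingular triangular form is the conic `X² / a - α Y² / b = 1`. Nonsingularity
forces `a ≠ 0` and `b ≠ 0`, since otherwise one of the coordinates `X`, `Y` would vanish on the image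
of the gradient. -/
theorem dualCurve_triangularForm (hα : α * α' = 1) (hN : r₁ ^ 2 - α * r₂ ^ 2 ≠ 0)
    (h2 : (2 : K) ≠ 0) (he : e ^ 2 = e) (h₁ : (r₁ ^ 2 - α * r₂ ^ 2) * δ₁ = e * r₁)
    (h₂ : (r₁ ^ 2 - α * r₂ ^ 2) * δ₂ = -(e * r₂))
    (hF : IsNonsingular (triangularForm m₁ m₂ δ₁ δ₂ n α')) :
    e + n * (r₁ ^ 2 - α * r₂ ^ 2) ≠ 0 ∧ n ≠ 0 ∧
      dualCurve (triangularForm m₁ m₂ δ₁ δ₂ n α') =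
        zeroSet (conicForm α r₁ r₂ (-(r₁ * m₁ + α * r₂ * m₂)) (-(r₁ * m₂ + r₂ * m₁))
          (e + n * (r₁ ^ 2 - α * r₂ ^ 2)) (n * (r₁ ^ 2 - α * r₂ ^ 2)) 1) := by
  have hsmul : ∀ (c : K) w, gradient (triangularForm m₁ m₂ δ₁ δ₂ n α') (c • w)
      = c • gradient (triangularForm m₁ m₂ δ₁ δ₂ n α') w := by
    intro c w
    rw [gradient_triangularForm, gradient_triangularForm]
    ext i
    fin_cases i <;> simp <;> ring
  have hsurj : Function.Surjective (gradient (triangularForm m₁ m₂ δ₁ δ₂ n α')) := by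
    refine gradient_surjective h2 (fun v w => ?_) hsmul (fun w => ?_) hF
    · rw [gradient_triangularForm, gradient_triangularForm, gradient_triangularForm]
      ext i
      fin_cases i <;> simp <;> ring
    · rw [gradient_triangularForm, eval_triangularForm, Fin.sum_univ_three]
      simp only [Matrix.cons_val_zero, Matrix.cons_val_one, Matrix.cons_val]
      ring
  have ha : e + n * (r₁ ^ 2 - α * r₂ ^ 2) ≠ 0 := by
    intro h0
    obtain ⟨w, hw⟩ := hsurj ![r₁, -r₂, 0]
    have := (gradient_triangularForm_coords (m₁ := m₁) (m₂ := m₂) (n := n) hα hN he h₁ h₂ w).1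
    rw [h0, hw] at this
    simp only [Matrix.cons_val_zero, Matrix.cons_val_one, Matrix.cons_val] at this
    exact hN (by linear_combination this)
  have hn : n ≠ 0 := by
    intro h0
    obtain ⟨w, hw⟩ := hsurj ![-(α * r₂), r₁, 0]
    have := (gradient_triangularForm_coords (m₁ := m₁) (m₂ := m₂) (n := n) hα hN he h₁ h₂ w).2
    rw [hw, h0] at this
    simp only [Matrix.cons_val_zero, Matrix.cons_val_one, Matrix.cons_val] at this
    exact hN (by linear_combination this)
  refine ⟨ha, hn, dualCurve_eq_zeroSet h2 hsmul (fun c w => ?_)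
    (eval_smul_conicForm _ _ _ _ _ _ _ _) (eval_conicForm_gradient hα hN he h₁ h₂ hn ha) hsurj⟩
  rw [eval_triangularForm, eval_triangularForm]
  simp only [Pi.smul_apply, smul_eq_mul]
  ring

end

/-! ### The conics `X² / a - α Y² / b = d` in the affine plane -/

/-- The point `z` of the plane `K` with `ρ z + τ = X + β Y`, where `p = (X, Y)`. -/
noncomputable def planePoint {k K : Type*} [Field k] [Field K] [Algebra k K]
    (β ρ τ : K) (p : k × k) : K :=
  (algebraMap k K p.1 + β * algebraMap k K p.2 - τ) / ρ

theorem planePoint_eq_iff {k K : Type*} [Field k] [Field K] [Algebra k K] {β ρ τ : K}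
    (hρ : ρ ≠ 0) (p : k × k) (z : K) :
    planePoint β ρ τ p = z ↔ ρ * z + τ = algebraMap k K p.1 + β * algebraMap k K p.2 := by
  rw [planePoint, div_eq_iff hρ, sub_eq_iff_eq_add, mul_comm z ρ, eq_comm]

namespace QuadraticExt

variable {k K : Type*} [Field k] [Finite k] [Field K] [Algebra k K] {q : ℕ} {α : k} {β : K}
  {r₁ r₂ t₁ t₂ a b d : k}

theorem mul_coords (h : QuadraticExt k K q α β) (x y : k) :
    (algebraMap k K r₁ + β * algebraMap k K r₂) * (algebraMap k K x + β * algebraMap k K y)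
      = algebraMap k K (r₁ * x + α * r₂ * y) + β * algebraMap k K (r₂ * x + r₁ * y) := by
  simp only [map_add, map_mul, ← h.sq_eq]
  ring

theorem conic_eq_zeroSet (h : QuadraticExt k K q α β) :
    conic q α β (algebraMap k K r₁ + β * algebraMap k K r₂)
        (algebraMap k K t₁ + β * algebraMap k K t₂) a b 0 d =
      zeroSet ((conicForm α r₁ r₂ t₁ t₂ a b d).map (algebraMap k K)) := by
  ext p
  simp only [conic, zeroSet, Set.mem_ofPred_eq, map_conicForm, eval_conicForm, h.re_coords,
    h.im_coords, map_zero, zero_mul, sub_zero]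
  rw [sub_eq_zero]

theorem mk_mem_conic (h : QuadraticExt k K q α β) {x y t : k}
    (hw : (![algebraMap k K x, algebraMap k K y, algebraMap k K t] : Fin 3 → K) ≠ 0) :
    Projectivization.mk K _ hw ∈ conic q α β (algebraMap k K r₁ + β * algebraMap k K r₂)
        (algebraMap k K t₁ + β * algebraMap k K t₂) a b 0 d ↔
      (r₁ * x + α * r₂ * y + t₁ * t) ^ 2 / a - α * ((r₂ * x + r₁ * y + t₂ * t) ^ 2 / b)
        = d * t ^ 2 := by
  rw [h.conic_eq_zeroSet, map_conicForm, mk_mem_zeroSet_conicForm, eval_conicForm, sub_eq_zero]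
  simp only [Matrix.cons_val_zero, Matrix.cons_val_one, Matrix.cons_val]
  simp only [← map_mul, ← map_add, ← map_pow, ← map_div₀, ← map_sub]
  exact (algebraMap k K).injective.eq_iff

theorem planePoint_injective (h : QuadraticExt k K q α β) {ρ τ : K} (hρ : ρ ≠ 0) :
    Function.Injective (planePoint (k := k) β ρ τ) := by
  intro p p' e
  rw [planePoint_eq_iff hρ] at e
  rw [(planePoint_eq_iff hρ p' _).mp rfl] at e
  obtain ⟨e1, e2⟩ := h.ext_coords e
  exact (Prod.ext e1 e2).symm

theorem affinePoints_conic (h : QuadraticExt k K q α β) {ρ τ : K} (hρ : ρ ≠ 0) :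
    affinePoints k β (conic q α β ρ τ a b 0 d) =
      planePoint β ρ τ '' {p : k × k | p.1 ^ 2 / a - α * (p.2 ^ 2 / b) = d} := by
  obtain ⟨r₁, r₂, rfl⟩ := h.exists_coords ρ
  obtain ⟨t₁, t₂, rfl⟩ := h.exists_coords τ
  have key : ∀ x y : k, (algebraMap k K r₁ + β * algebraMap k K r₂)
        * (algebraMap k K x + β * algebraMap k K y) + (algebraMap k K t₁ + β * algebraMap k K t₂)
      = algebraMap k K (r₁ * x + α * r₂ * y + t₁) + β * algebraMap k K (r₂ * x + r₁ * y + t₂) := by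
    intro x y
    rw [h.mul_coords]
    simp only [map_add]
    ring
  have hmem : ∀ (x y : k) (hw : (![algebraMap k K x, algebraMap k K y, 1] : Fin 3 → K) ≠ 0),
      Projectivization.mk K _ hw ∈ conic q α β (algebraMap k K r₁ + β * algebraMap k K r₂)
        (algebraMap k K t₁ + β * algebraMap k K t₂) a b 0 d ↔
      (r₁ * x + α * r₂ * y + t₁) ^ 2 / a - α * ((r₂ * x + r₁ * y + t₂) ^ 2 / b) = d := by
    intro x y hw
    have hw' : (![algebraMap k K x, algebraMap k K y, algebraMap k K 1] : Fin 3 → K) ≠ 0 := by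
      rwa [map_one]
    have := h.mk_mem_conic (r₁ := r₁) (r₂ := r₂) (t₁ := t₁) (t₂ := t₂) (a := a) (b := b) (d := d) hw'
    simp only [map_one, mul_one, one_pow] at this
    exact this
  ext z
  constructor
  · rintro ⟨x, y, rfl, hw, hz⟩
    rw [hmem] at hz
    exact ⟨(_, _), hz, (planePoint_eq_iff hρ _ _).mpr (key x y)⟩
  · rintro ⟨p, hp, hz⟩
    rw [planePoint_eq_iff hρ] at hz
    obtain ⟨x, y, rfl⟩ := h.exists_coords z
    rw [key] at hz
    obtain ⟨e1, e2⟩ := h.ext_coords hz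
    have hw : (![algebraMap k K x, algebraMap k K y, 1] : Fin 3 → K) ≠ 0 := fun e => by
      simpa using congrFun e 2
    refine ⟨x, y, rfl, hw, (hmem x y hw).mpr ?_⟩
    rw [e1, e2]
    exact hp

theorem isSmoothConic_conic (h : QuadraticExt k K q α β) {ρ τ : K} (hρ : ρ ≠ 0)
    (ha : a ≠ 0) (hb : b ≠ 0) (hd : d ≠ 0) : IsSmoothConic k (conic q α β ρ τ a b 0 d) := by
  obtain ⟨r₁, r₂, rfl⟩ := h.exists_coords ρ
  obtain ⟨t₁, t₂, rfl⟩ := h.exists_coords τ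
  refine ⟨conicForm α r₁ r₂ t₁ t₂ a b d, isHomogeneous_conicForm .., ?_, h.conic_eq_zeroSet⟩
  rw [map_conicForm]
  have hinj : ∀ x : k, x ≠ 0 → algebraMap k K x ≠ 0 := fun x => (map_ne_zero _).mpr
  refine isNonsingular_conicForm _ _ h.two_ne_zero' ?_ (hinj _ h.α_ne_zero) (hinj _ ha)
    (hinj _ hb) (hinj _ hd)
  have := hinj _ (h.sub_mul_sq_ne_zero hρ)
  simpa using this

/-- If `a b` is a square, the form `X² / a - α Y² / b` is anisotropic. -/
theorem eq_zero_of_isSquare (h : QuadraticExt k K q α β) (ha : a ≠ 0) (hb : b ≠ 0)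
    (hab : IsSquare (a * b)) {X Y : k} (e : X ^ 2 / a - α * (Y ^ 2 / b) = 0) :
    X = 0 ∧ Y = 0 := by
  obtain ⟨g, hg⟩ := hab
  have hg0 : g ≠ 0 := by
    rintro rfl
    exact mul_ne_zero ha hb (by rw [hg, mul_zero])
  have e' : (g * X) ^ 2 = α * (a * Y) ^ 2 := by
    field_simp at e
    linear_combination a * e - X ^ 2 * hg
  have hY0 : Y = 0 := by
    by_contra hne
    have := mul_ne_zero ha hne
    refine h.not_isSquare ⟨g * X / (a * Y), ?_⟩
    rw [← pow_two, div_pow, e', mul_div_cancel_right₀ _ (pow_ne_zero 2 this)]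
  refine ⟨?_, hY0⟩
  rw [hY0, mul_zero, zero_pow (by norm_num), mul_zero] at e'
  exact (mul_eq_zero.mp (eq_zero_of_pow_eq_zero e')).resolve_left hg0

theorem infinitePoints_eq_empty (h : QuadraticExt k K q α β) {ρ τ : K} (hρ : ρ ≠ 0)
    (ha : a ≠ 0) (hb : b ≠ 0) (hab : IsSquare (a * b)) :
    infinitePoints k (conic q α β ρ τ a b 0 d) = ∅ := by
  obtain ⟨r₁, r₂, rfl⟩ := h.exists_coords ρ
  obtain ⟨t₁, t₂, rfl⟩ := h.exists_coords τ
  refine Set.eq_empty_of_forall_notMem ?_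
  rintro p ⟨hp, x, y, hw, rfl⟩
  have hw' : (![algebraMap k K x, algebraMap k K y, algebraMap k K 0] : Fin 3 → K) ≠ 0 := by
    rwa [map_zero]
  have := h.mk_mem_conic (r₁ := r₁) (r₂ := r₂) (t₁ := t₁) (t₂ := t₂) (a := a) (b := b) (d := d) hw'
  simp only [map_zero, mul_zero, add_zero, zero_pow (M₀ := k) (n := 2) (by norm_num)] at this
  have e := this.mp hp
  obtain ⟨hX0, hY0⟩ := h.eq_zero_of_isSquare ha hb hab e
  obtain ⟨hx, hy⟩ := coords_eq_zero (h.sub_mul_sq_ne_zero hρ) hX0 hY0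
  refine hw (funext fun i => ?_)
  fin_cases i <;> simp [hx, hy]

/-- If `α a b = g²`, the two points at infinity have the coordinates `(X : Y) = (± g : b)`. -/
theorem ncard_infinitePoints (h : QuadraticExt k K q α β) {ρ τ : K} (hρ : ρ ≠ 0)
    (ha : a ≠ 0) (hb : b ≠ 0) (hab : ¬ IsSquare (a * b)) :
    (infinitePoints k (conic q α β ρ τ a b 0 d)).ncard = 2 := by
  obtain ⟨r₁, r₂, rfl⟩ := h.exists_coords ρ
  obtain ⟨t₁, t₂, rfl⟩ := h.exists_coords τ
  obtain ⟨g, hg⟩ := isSquare_mul_of_not_isSquare h.not_isSquare hab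
  have hN := h.sub_mul_sq_ne_zero hρ
  have hg0 : g ≠ 0 := by
    rintro rfl
    exact mul_ne_zero h.α_ne_zero (mul_ne_zero ha hb) (by rw [hg, mul_zero])
  set N := r₁ ^ 2 - α * r₂ ^ 2 with hNdef
  have hmem : ∀ (x y : k) (hw : (![algebraMap k K x, algebraMap k K y, 0] : Fin 3 → K) ≠ 0),
      Projectivization.mk K _ hw ∈ conic q α β (algebraMap k K r₁ + β * algebraMap k K r₂)
        (algebraMap k K t₁ + β * algebraMap k K t₂) a b 0 d ↔
      (r₁ * x + α * r₂ * y) ^ 2 / a - α * ((r₂ * x + r₁ * y) ^ 2 / b) = 0 := by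
    intro x y hw
    have hw' : (![algebraMap k K x, algebraMap k K y, algebraMap k K 0] : Fin 3 → K) ≠ 0 := by
      rwa [map_zero]
    have := h.mk_mem_conic (r₁ := r₁) (r₂ := r₂) (t₁ := t₁) (t₂ := t₂) (a := a) (b := b) (d := d) hw'
    simp only [map_zero, mul_zero, add_zero, zero_pow (M₀ := k) (n := 2) (by norm_num)] at this
    exact this
  have hpt : ∀ γ : k, (![algebraMap k K (r₁ * γ - α * r₂ * b), algebraMap k K (r₁ * b - r₂ * γ), 0] :
      Fin 3 → K) ≠ 0 := by
    intro γ e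
    have e0 : r₁ * γ - α * r₂ * b = 0 := (algebraMap k K).injective (by simpa using congrFun e 0)
    have e1 : r₁ * b - r₂ * γ = 0 := (algebraMap k K).injective (by simpa using congrFun e 1)
    refine mul_ne_zero hN hb ?_
    rw [hNdef]
    linear_combination r₂ * e0 + r₁ * e1
  have hset : infinitePoints k (conic q α β (algebraMap k K r₁ + β * algebraMap k K r₂)
        (algebraMap k K t₁ + β * algebraMap k K t₂) a b 0 d)
      = {Projectivization.mk K _ (hpt g), Projectivization.mk K _ (hpt (-g))} := by
    have hin : ∀ γ : k, γ ^ 2 = g ^ 2 → Projectivization.mk K _ (hpt γ) ∈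
        infinitePoints k (conic q α β (algebraMap k K r₁ + β * algebraMap k K r₂)
          (algebraMap k K t₁ + β * algebraMap k K t₂) a b 0 d) := by
      intro γ hγ
      refine ⟨(hmem _ _ (hpt γ)).mpr ?_, _, _, hpt γ, rfl⟩
      have e1 : r₁ * (r₁ * γ - α * r₂ * b) + α * r₂ * (r₁ * b - r₂ * γ) = N * γ := by
        rw [hNdef]; ring
      have e2 : r₂ * (r₁ * γ - α * r₂ * b) + r₁ * (r₁ * b - r₂ * γ) = N * b := by
        rw [hNdef]; ring
      rw [e1, e2]
      field_simp
      linear_combination N ^ 2 * hγ - N ^ 2 * hg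
    refine Set.Subset.antisymm ?_ ?_
    · rintro p ⟨hp, x, y, hw, rfl⟩
      rw [hmem] at hp
      set X := r₁ * x + α * r₂ * y with hX
      set Y := r₂ * x + r₁ * y with hY
      have hsq : (b * X) ^ 2 = (g * Y) ^ 2 := by
        field_simp at hp
        linear_combination b * hp + Y ^ 2 * hg
      have hfin : ∀ γ : k, b * X = γ * Y →
          Projectivization.mk K _ hw = Projectivization.mk K _ (hpt γ) := by
        intro γ e
        rw [Projectivization.mk_eq_mk_iff']
        refine ⟨algebraMap k K (Y / (N * b)), funext fun i => ?_⟩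
        have hx : Y / (N * b) * (r₁ * γ - α * r₂ * b) = x := by
          field_simp
          rw [hNdef]
          linear_combination -r₁ * e + b * r₁ * hX - α * b * r₂ * hY
        have hy : Y / (N * b) * (r₁ * b - r₂ * γ) = y := by
          field_simp
          rw [hNdef]
          linear_combination r₂ * e + b * r₁ * hY - b * r₂ * hX
        fin_cases i
        · simp only [Fin.zero_eta, Pi.smul_apply, smul_eq_mul, Matrix.cons_val_zero]
          rw [← map_mul, hx]
        · simp only [Fin.mk_one, Pi.smul_apply, smul_eq_mul, Matrix.cons_val_one,
            Matrix.cons_val_zero]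
          rw [← map_mul, hy]
        · simp
      rcases sq_eq_sq_iff_eq_or_eq_neg.mp hsq with e | e
      · exact Or.inl (hfin g e)
      · exact Or.inr (hfin (-g) (by rw [e]; ring))
    · rintro p (rfl | rfl)
      · exact hin g rfl
      · exact hin (-g) (neg_sq g)
  rw [hset]
  refine Set.ncard_pair ?_
  intro e
  rw [Projectivization.mk_eq_mk_iff'] at e
  obtain ⟨c, hc⟩ := e
  have c0 := congrFun hc 0
  have c1 := congrFun hc 1
  simp only [Pi.smul_apply, smul_eq_mul, Matrix.cons_val_zero, Matrix.cons_val_one, map_sub,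
    map_mul, map_neg] at c0 c1
  have hNK : algebraMap k K r₁ ^ 2 - algebraMap k K α * algebraMap k K r₂ ^ 2 ≠ 0 := by
    have := (map_ne_zero (algebraMap k K)).mpr hN
    simpa [hNdef] using this
  have hbK : algebraMap k K b ≠ 0 := (map_ne_zero _).mpr hb
  have hgK : algebraMap k K g ≠ 0 := (map_ne_zero _).mpr hg0
  have hc1 : c = 1 := by
    refine mul_right_cancel₀ (mul_ne_zero hNK hbK) ?_
    linear_combination algebraMap k K r₂ * c0 + algebraMap k K r₁ * c1
  rw [hc1] at c0 c1
  refine mul_ne_zero h.two_ne_zero' (mul_ne_zero hNK hgK) ?_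
  linear_combination -algebraMap k K r₁ * c0 - algebraMap k K α * algebraMap k K r₂ * c1

theorem ncard_affinePoints_of_isSquare (h : QuadraticExt k K q α β) {ρ τ : K} (hρ : ρ ≠ 0)
    (ha : a ≠ 0) (hb : b ≠ 0) (hd : d ≠ 0) (hab : IsSquare (a * b)) :
    (affinePoints k β (conic q α β ρ τ a b 0 d)).ncard = q + 1 := by
  obtain ⟨g, hg⟩ := hab
  have hg0 : g ≠ 0 := by
    rintro rfl
    exact mul_ne_zero ha hb (by rw [hg, mul_zero])
  rw [h.affinePoints_conic hρ, Set.ncard_image_of_injective _ (h.planePoint_injective hρ),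
    ← h.ncard_anisotropic (div_ne_zero hg0 hb) (mul_ne_zero ha hd)]
  congr 1
  ext p
  simp only [Set.mem_ofPred_eq]
  have e : p.1 ^ 2 - α * (g / b) ^ 2 * p.2 ^ 2 = a * (p.1 ^ 2 / a - α * (p.2 ^ 2 / b)) := by
    field_simp
    linear_combination α * p.2 ^ 2 * hg
  rw [e, mul_right_inj' ha]

theorem ncard_affinePoints_of_not_isSquare (h : QuadraticExt k K q α β) {ρ τ : K} (hρ : ρ ≠ 0)
    (ha : a ≠ 0) (hb : b ≠ 0) (hd : d ≠ 0) (hab : ¬ IsSquare (a * b)) :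
    (affinePoints k β (conic q α β ρ τ a b 0 d)).ncard = q - 1 := by
  obtain ⟨g, hg⟩ := isSquare_mul_of_not_isSquare h.not_isSquare hab
  have hg0 : g ≠ 0 := by
    rintro rfl
    exact mul_ne_zero h.α_ne_zero (mul_ne_zero ha hb) (by rw [hg, mul_zero])
  rw [h.affinePoints_conic hρ, Set.ncard_image_of_injective _ (h.planePoint_injective hρ),
    ← h.card_eq, ← ncard_isotropic h.two_ne_zero (div_ne_zero hg0 hb) (mul_ne_zero ha hd)]
  congr 1
  ext p
  simp only [Set.mem_ofPred_eq]
  have e : p.1 ^ 2 - (g / b) ^ 2 * p.2 ^ 2 = a * (p.1 ^ 2 / a - α * (p.2 ^ 2 / b)) := by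
    field_simp
    linear_combination p.2 ^ 2 * hg
  rw [e, mul_right_inj' ha]

theorem affinePoints_conic_zero (h : QuadraticExt k K q α β) {ρ τ : K} (hρ : ρ ≠ 0)
    (ha : a ≠ 0) (hb : b ≠ 0) (hab : IsSquare (a * b)) :
    affinePoints k β (conic q α β ρ τ a b 0 0) = {planePoint β ρ τ ((0, 0) : k × k)} := by
  rw [h.affinePoints_conic hρ, ← Set.image_singleton]
  congr 1
  ext p
  simp only [Set.mem_ofPred_eq, Set.mem_singleton_iff]
  constructor
  · intro e
    obtain ⟨hX0, hY0⟩ := h.eq_zero_of_isSquare ha hb hab e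
    exact Prod.ext hX0 hY0
  · rintro rfl
    simp

end QuadraticExt

/-! ### The numerical range as a union of conics -/

/-- The equation `(X - e r)² - α Y² = n (1 - r²)` is quadratic in `r`; completing the square by
`g = (e + n) r - e X` turns it into the equation of a conic of the pencil. -/
theorem exists_sub_sq_iff {k : Type*} [Field k] {α n e X Y : k} (he : e ^ 2 = e) (hn : n ≠ 0)
    (ha : e + n ≠ 0) :
    (∃ r, (X - e * r) ^ 2 - α * Y ^ 2 = n * (1 - r ^ 2)) ↔
      ∃ g, X ^ 2 / (e + n) - α * (Y ^ 2 / n) = 1 - g ^ 2 / ((e + n) * n) := by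
  constructor
  · rintro ⟨r, hr⟩
    refine ⟨(e + n) * r - e * X, ?_⟩
    field_simp
    linear_combination (e + n) * hr + (X ^ 2 - (e + n) * r ^ 2) * he
  · rintro ⟨g, hg⟩
    refine ⟨(g + e * X) / (e + n), ?_⟩
    field_simp at hg ⊢
    linear_combination (e + n) * hg + (-X ^ 2 * (e + n) + (g + e * X) ^ 2) * he

namespace QuadraticExt

variable {k K : Type*} [Field k] [Finite k] [Field K] [Algebra k K] {q : ℕ} {α : k} {β : K}

theorem mem_numericalRange_iff_conic (h : QuadraticExt k K q α β) {mid δ s ρ : K}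
    {r₁ r₂ e n : k} (hρe : ρ = algebraMap k K r₁ + β * algebraMap k K r₂) (hρ : ρ ≠ 0)
    (hδ : δ * ρ = algebraMap k K e) (he : e ^ 2 = e) (hs : conj q s * s = algebraMap k K (4 * n))
    (hn : n ≠ 0) (ha : e + n * (r₁ ^ 2 - α * r₂ ^ 2) ≠ 0) (z : K) :
    z ∈ numericalRange q !![mid + δ, s; 0, mid - δ] ↔
      ∃ g : k, z ∈ affinePoints k β (conic q α β ρ (-(ρ * mid))
        (e + n * (r₁ ^ 2 - α * r₂ ^ 2)) (n * (r₁ ^ 2 - α * r₂ ^ 2)) 0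
        (1 - g ^ 2 / ((e + n * (r₁ ^ 2 - α * r₂ ^ 2)) * (n * (r₁ ^ 2 - α * r₂ ^ 2))))) := by
  have hN : r₁ ^ 2 - α * r₂ ^ 2 ≠ 0 := h.sub_mul_sq_ne_zero (hρe ▸ hρ)
  have hρN : conj q ρ * ρ = algebraMap k K (r₁ ^ 2 - α * r₂ ^ 2) := by
    rw [hρe, h.conj_mul_self_coords]
  set N := r₁ ^ 2 - α * r₂ ^ 2
  have hnN : n * N ≠ 0 := mul_ne_zero hn hN
  have h4 : (4 : k) ≠ 0 := by
    rw [show (4 : k) = 2 * 2 by norm_num]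
    exact mul_ne_zero h.two_ne_zero h.two_ne_zero
  have h4' : (4 : K) ≠ 0 := by
    have := (map_ne_zero (algebraMap k K)).mpr h4
    rwa [map_ofNat] at this
  have hs0 : s ≠ 0 := by
    rintro rfl
    rw [mul_zero, eq_comm, map_eq_zero] at hs
    exact mul_ne_zero h4 hn hs
  simp only [h.affinePoints_conic hρ, Set.mem_image, Set.mem_ofPred_eq]
  rw [h.mem_numericalRange_triangular rfl rfl]
  -- the norm of `ρ s m` is `4 n N` times the norm of `m`
  have hnorm : ∀ m : K, conj q (ρ * s * m) * (ρ * s * m)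
      = algebraMap k K (n * N) * (4 * (conj q m * m)) := by
    intro m
    rw [map_mul, map_ofNat] at hs
    rw [conj_mul, conj_mul, map_mul]
    linear_combination conj q s * s * (conj q m * m) * hρN
      + algebraMap k K N * (conj q m * m) * hs
  have hnNK : algebraMap k K (n * N) ≠ 0 := (map_ne_zero _).mpr hnN
  constructor
  · rintro ⟨r, m, hm, rfl⟩
    obtain ⟨x, y, hxy⟩ := h.exists_coords (ρ * s * m)
    have hk : (e * r + x - e * r) ^ 2 - α * y ^ 2 = n * N * (1 - r ^ 2) := by
      refine (algebraMap k K).injective ?_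
      rw [add_sub_cancel_left, ← h.conj_mul_self_coords, ← hxy, hnorm, hm, ← map_mul]
    obtain ⟨g, hg⟩ := (exists_sub_sq_iff he hnN ha).mp ⟨r, hk⟩
    refine ⟨g, (e * r + x, y), hg, (planePoint_eq_iff hρ _ _).mpr ?_⟩
    simp only [map_add, map_mul]
    linear_combination hxy + algebraMap k K r * hδ
  · rintro ⟨g, p, hg, hp⟩
    rw [planePoint_eq_iff hρ] at hp
    obtain ⟨r, hr⟩ := (exists_sub_sq_iff he hnN ha).mpr ⟨g, hg⟩
    have hm : ρ * s * ((algebraMap k K (p.1 - e * r) + β * algebraMap k K p.2) / (ρ * s))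
        = algebraMap k K (p.1 - e * r) + β * algebraMap k K p.2 :=
      mul_div_cancel₀ _ (mul_ne_zero hρ hs0)
    set m := (algebraMap k K (p.1 - e * r) + β * algebraMap k K p.2) / (ρ * s)
    refine ⟨r, m, ?_, ?_⟩
    · refine mul_left_cancel₀ hnNK ?_
      rw [← hnorm, hm, h.conj_mul_self_coords, hr, map_mul]
    · refine mul_left_cancel₀ hρ ?_
      rw [map_sub, map_mul] at hm
      linear_combination hp - hm - algebraMap k K r * hδ

/-- Both the boundary curve (`d = 1`) and the numerical range (`d = 1 - g² / (a b)`, `g ∈ k`) are given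
by the pencil of conics `X² / a - α Y² / b = d`. The coordinates centre the plane at half the trace
of `A` and, when the eigenvalues differ, scale half their difference to `1`; then `b` is a quarter
of the norm of the scaled off-diagonal entry of the triangular form of `A`, and `a` is `b + 1` or,
for equal eigenvalues, `b`. -/
theorem exists_pencil (h : QuadraticExt k K q α β) {A : Matrix (Fin 2) (Fin 2) K}
    (hF : IsNonsingular (basePoly q β A)) {μ : K} {u : Fin 2 → K}
    (hAu : A.mulVec u = μ • u) (hu : herm q u u ≠ 0) :
    ∃ (ρ τ : K) (a b : k), ρ ≠ 0 ∧ a ≠ 0 ∧ b ≠ 0 ∧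
      boundaryCurve q β A = conic q α β ρ τ a b 0 1 ∧
      ∀ z, z ∈ numericalRange q A ↔
        ∃ g : k, z ∈ affinePoints k β (conic q α β ρ τ a b 0 (1 - g ^ 2 / (a * b))) := by
  have h2 := h.two_ne_zero'
  obtain ⟨U, s, ν, hU, hU', hA⟩ := h.exists_unitary_triangular hAu hu
  set mid := (μ + ν) / 2 with hmid
  set δ := (μ - ν) / 2 with hδ
  have hμ : μ = mid + δ := by rw [hmid, hδ]; field_simp; ring
  have hν : ν = mid - δ := by rw [hmid, hδ]; field_simp; ring
  -- scale by `δ⁻¹`, unless the two eigenvalues coincide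
  obtain ⟨ρ, e, hρ, he, hδρ⟩ : ∃ (ρ : K) (e : k), ρ ≠ 0 ∧ e ^ 2 = e ∧ δ * ρ = algebraMap k K e := by
    by_cases h0 : δ = 0
    · exact ⟨1, 0, one_ne_zero, by norm_num, by simp [h0]⟩
    · exact ⟨δ⁻¹, 1, inv_ne_zero h0, by norm_num, by rw [mul_inv_cancel₀ h0, map_one]⟩
  obtain ⟨r₁, r₂, hρe⟩ := h.exists_coords ρ
  obtain ⟨m₁, m₂, hme⟩ := h.exists_coords mid
  obtain ⟨δ₁, δ₂, hδe⟩ := h.exists_coords δ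
  obtain ⟨n, hn⟩ : ∃ n : k, conj q s * s = algebraMap k K (4 * n) := by
    obtain ⟨x, y, hs⟩ := h.exists_coords s
    refine ⟨(x ^ 2 - α * y ^ 2) / 4, ?_⟩
    have h4 : (4 : k) ≠ 0 := by
      rw [show (4 : k) = 2 * 2 by norm_num]
      exact mul_ne_zero h.two_ne_zero h.two_ne_zero
    rw [hs, h.conj_mul_self_coords, mul_div_cancel₀ _ h4]
  have hN : r₁ ^ 2 - α * r₂ ^ 2 ≠ 0 := h.sub_mul_sq_ne_zero (hρe ▸ hρ)
  obtain ⟨k1, k2⟩ : r₁ * δ₁ + α * r₂ * δ₂ = e ∧ r₂ * δ₁ + r₁ * δ₂ = 0 := by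
    refine h.ext_coords ?_
    rw [← h.mul_coords, ← hρe, ← hδe, mul_comm, hδρ, map_zero, mul_zero, add_zero]
  have hbase : basePoly q β A = triangularForm (algebraMap k K m₁) (algebraMap k K m₂)
      (algebraMap k K δ₁) (algebraMap k K δ₂) (algebraMap k K n) (algebraMap k K α⁻¹) := by
    rw [hA, h.basePoly_unitary_conj hU', h.basePoly_triangular (m₁ := m₁) (m₂ := m₂) (δ₁ := δ₁)
      (δ₂ := δ₂) ?_ ?_ hn, triangularForm]
    · rw [hμ, hme, hδe]
      simp only [map_add]
      ring
    · rw [hν, hme, hδe]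
      simp only [map_sub]
      ring
  rw [hbase] at hF
  have hmap : algebraMap k K r₁ ^ 2 - algebraMap k K α * algebraMap k K r₂ ^ 2
      = algebraMap k K (r₁ ^ 2 - α * r₂ ^ 2) := by simp
  obtain ⟨ha, hn0, hdual⟩ := dualCurve_triangularForm (α := algebraMap k K α)
    (r₁ := algebraMap k K r₁) (r₂ := algebraMap k K r₂) (e := algebraMap k K e)
    (by rw [← map_mul, mul_inv_cancel₀ h.α_ne_zero, map_one])
    (by rw [hmap]; exact (map_ne_zero _).mpr hN) h2 (by rw [← map_pow, he])
    (by
      rw [hmap, ← map_mul, ← map_mul]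
      congr 1
      linear_combination r₁ * k1 - α * r₂ * k2)
    (by
      rw [hmap, ← map_mul, ← map_mul, ← map_neg]
      congr 1
      linear_combination r₁ * k2 - r₂ * k1) hF
  have ha' : e + n * (r₁ ^ 2 - α * r₂ ^ 2) ≠ 0 := by
    intro h0
    rw [hmap, ← map_mul, ← map_add, h0, map_zero] at ha
    exact ha rfl
  have hn0' : n ≠ 0 := (map_ne_zero _).mp hn0
  refine ⟨ρ, -(ρ * mid), e + n * (r₁ ^ 2 - α * r₂ ^ 2), n * (r₁ ^ 2 - α * r₂ ^ 2), hρ, ha',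
    mul_ne_zero hn0' hN, ?_, ?_⟩
  · have hτ : -(ρ * mid) = algebraMap k K (-(r₁ * m₁ + α * r₂ * m₂))
        + β * algebraMap k K (-(r₁ * m₂ + r₂ * m₁)) := by
      rw [hρe, hme, h.mul_coords]
      simp only [map_neg, map_add, map_mul]
      ring
    rw [boundaryCurve, hbase, hdual, hτ, hρe, h.conic_eq_zeroSet, map_conicForm]
    simp only [map_neg, map_add, map_mul, map_sub, map_pow, map_one]
  · intro z
    rw [hA, h.numericalRange_unitary_conj hU hU', hμ, hν]
    exact h.mem_numericalRange_iff_conic hρe hρ hδρ he hn hn0' ha' z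

end QuadraticExt

end FFNR

theorem mainTheorem1 {k K : Type*} [Field k] [Finite k] [Field K] [Algebra k K]
    (hK : Module.finrank k K = 2) (q : ℕ) (hq : Nat.card k = q) (hodd : Odd q)
    (α : k) (hα : ¬ IsSquare α) (β : K) (hβ : β ^ 2 = algebraMap k K α)
    (A : Matrix (Fin 2) (Fin 2) K)
    (hF : FFNR.IsNonsingular (FFNR.basePoly q β A))
    (hA : ∃ (μ : K) (u : Fin 2 → K),
      Module.End.HasEigenvector (Matrix.toLin' A) μ u ∧ FFNR.herm q u u ≠ 0) :
    ∃ (ρ τ : K) (a b c : k) (d : ℕ → k), ρ ≠ 0 ∧ a * b ≠ 0 ∧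
      FFNR.boundaryCurve q β A = FFNR.conic q α β ρ τ a b c (d 1) ∧
      (FFNR.IsEllipse k (FFNR.conic q α β ρ τ a b c (d 1)) ∨
        FFNR.IsHyperbola k (FFNR.conic q α β ρ τ a b c (d 1))) ∧
      FFNR.numericalRange q A =
        ⋃ i ∈ Set.Icc 1 ((q + 1) / 2),
          FFNR.affinePoints k β (FFNR.conic q α β ρ τ a b c (d i)) ∧
      (Set.Icc 1 ((q + 1) / 2)).PairwiseDisjoint
        (fun i => FFNR.affinePoints k β (FFNR.conic q α β ρ τ a b c (d i))) ∧
      (FFNR.IsEllipse k (FFNR.conic q α β ρ τ a b c (d 1)) →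
        d 2 = 0 ∧
        (∃ z : K, ρ * z + τ = algebraMap k K c ∧
          FFNR.affinePoints k β (FFNR.conic q α β ρ τ a b c (d 2)) = {z}) ∧
        (∀ i ∈ Set.Icc 1 ((q + 1) / 2), i ≠ 2 →
          (FFNR.affinePoints k β (FFNR.conic q α β ρ τ a b c (d i))).ncard = q + 1) ∧
        (FFNR.numericalRange q A).ncard = (q ^ 2 + 1) / 2) ∧
      (FFNR.IsHyperbola k (FFNR.conic q α β ρ τ a b c (d 1)) →
        (∀ i ∈ Set.Icc 1 ((q + 1) / 2),
          (FFNR.affinePoints k β (FFNR.conic q α β ρ τ a b c (d i))).ncard = q - 1) ∧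
        (FFNR.numericalRange q A).ncard = (q ^ 2 - 1) / 2) := by
  classical
  obtain ⟨μ, u, hμu, hu⟩ := hA
  have h : FFNR.QuadraticExt k K q α β := ⟨hK, hq, hodd, hα, hβ⟩
  have hAu : A.mulVec u = μ • u := by
    rw [← Matrix.toLin'_apply]
    exact hμu.apply_eq_smul
  obtain ⟨ρ, τ, a, b, hρ, ha, hb, hbd, hW⟩ := h.exists_pencil hF hAu hu
  have hab := mul_ne_zero ha hb
  have := h.finite_K
  set S : Set k := Set.range fun g : k => 1 - g ^ 2 / (a * b) with hS
  have hcard : S.ncard = (q + 1) / 2 := by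
    rw [hS, FFNR.ncard_one_sub_sq_div (by rw [hq]; exact hodd) hab, hq]
  have m1 : (1 : k) ∈ S := ⟨0, by simp⟩
  -- `0` is a value of `1 - g² / (a b)` exactly if `a b` is a square
  obtain ⟨x₂, hx₂, hne, hsq⟩ : ∃ x₂ ∈ S, (1 : k) ≠ x₂ ∧ (IsSquare (a * b) → x₂ = 0) := by
    by_cases hs : IsSquare (a * b)
    · obtain ⟨g, hg⟩ := hs
      refine ⟨0, ⟨g, ?_⟩, one_ne_zero, fun _ => rfl⟩
      simp only
      rw [pow_two, ← hg, div_self hab, sub_self]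
    · refine ⟨1 - 1 ^ 2 / (a * b), ⟨1, rfl⟩, ?_, fun h => absurd h hs⟩
      intro e
      refine div_ne_zero one_ne_zero hab ?_
      linear_combination e
  have hzero : (0 : k) ∈ S → IsSquare (a * b) := by
    rintro ⟨g, hg⟩
    refine ⟨g, ?_⟩
    simp only at hg
    field_simp at hg
    linear_combination hg
  obtain ⟨d, hd, hd1, hd2⟩ := FFNR.exists_enumeration S.toFinite m1 hx₂ hne
  rw [hcard] at hd
  have hWU : FFNR.numericalRange q A = ⋃ i ∈ Set.Icc 1 ((q + 1) / 2),
      FFNR.affinePoints k β (FFNR.conic q α β ρ τ a b 0 (d i)) := by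
    ext z
    rw [hW]
    simp only [Set.mem_iUnion]
    constructor
    · rintro ⟨g, hz⟩
      obtain ⟨i, hi, e⟩ := hd.surjOn ⟨g, rfl⟩
      exact ⟨i, hi, by rw [e]; exact hz⟩
    · rintro ⟨i, hi, hz⟩
      obtain ⟨g, hg⟩ := hd.mapsTo hi
      exact ⟨g, by simpa only [hg] using hz⟩
  have hdisj : (Set.Icc 1 ((q + 1) / 2)).PairwiseDisjoint
      (fun i => FFNR.affinePoints k β (FFNR.conic q α β ρ τ a b 0 (d i))) := by
    intro i hi j hj hij
    simp only [Function.onFun, h.affinePoints_conic hρ]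
    rw [Set.disjoint_image_iff (h.planePoint_injective hρ), Set.disjoint_left]
    intro p hp hp'
    exact hij (hd.injOn hi hj ((hp : _ = d i).symm.trans hp'))
  have hsum : (FFNR.numericalRange q A).ncard = ∑ i ∈ Finset.Icc 1 ((q + 1) / 2),
      (FFNR.affinePoints k β (FFNR.conic q α β ρ τ a b 0 (d i))).ncard := by
    rw [hWU, (Set.finite_Icc 1 ((q + 1) / 2)).ncard_biUnion (fun _ _ => Set.toFinite _) hdisj,
      ← Finset.coe_Icc, finsum_mem_coe_finset]
  have h3 := h.three_le
  have hsmooth := h.isSmoothConic_conic (τ := τ) hρ ha hb (one_ne_zero (α := k))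
  refine ⟨ρ, τ, a, b, 0, d, hρ, hab, by rw [hd1, hbd], ?_, hWU, hdisj, ?_, ?_⟩
  · rw [hd1]
    by_cases hs : IsSquare (a * b)
    · exact Or.inl ⟨hsmooth, h.infinitePoints_eq_empty hρ ha hb hs⟩
    · exact Or.inr ⟨hsmooth, h.ncard_infinitePoints hρ ha hb hs⟩
  · rintro ⟨-, hinf⟩
    have hs : IsSquare (a * b) := by
      by_contra hs
      have := h.ncard_infinitePoints (τ := τ) (d := d 1) hρ ha hb hs
      rw [hinf, Set.ncard_empty] at this
      omega
    have hd20 : d 2 = 0 := by rw [hd2, hsq hs]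
    have mem2 : 2 ∈ Finset.Icc 1 ((q + 1) / 2) := Finset.mem_Icc.mpr (by omega)
    have hc2 := h.affinePoints_conic_zero (τ := τ) hρ ha hb hs
    have hcount : ∀ i ∈ Set.Icc 1 ((q + 1) / 2), i ≠ 2 →
        (FFNR.affinePoints k β (FFNR.conic q α β ρ τ a b 0 (d i))).ncard = q + 1 := by
      intro i hi hi2
      refine h.ncard_affinePoints_of_isSquare hρ ha hb (fun h0 => hi2 ?_) hs
      exact hd.injOn hi (by simpa using mem2) (h0.trans hd20.symm)
    have hcentre := (FFNR.planePoint_eq_iff (β := β) (τ := τ) hρ ((0, 0) : k × k) _).mp rfl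
    refine ⟨hd20, ⟨_, hcentre.trans (by simp), ?_⟩, hcount, ?_⟩
    · rw [hd20, hc2]
    · rw [hsum, ← Finset.add_sum_erase _ _ mem2, hd20, hc2, Set.ncard_singleton,
        Finset.sum_const_nat (m := q + 1), Finset.card_erase_of_mem mem2, Nat.card_Icc]
      · obtain ⟨m, rfl⟩ := hodd
        rw [show (2 * m + 1 + 1) / 2 + 1 - 1 - 1 = m by omega,
          show (2 * m + 1) ^ 2 + 1 = 2 * (1 + m * (2 * m + 1 + 1)) by ring]
        omega
      · intro i hi
        exact hcount i (by simpa using Finset.mem_of_mem_erase hi) (Finset.ne_of_mem_erase hi)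
  · rintro ⟨-, hinf⟩
    have hs : ¬ IsSquare (a * b) := by
      intro hs
      rw [h.infinitePoints_eq_empty hρ ha hb hs, Set.ncard_empty] at hinf
      omega
    have hcount : ∀ i ∈ Set.Icc 1 ((q + 1) / 2),
        (FFNR.affinePoints k β (FFNR.conic q α β ρ τ a b 0 (d i))).ncard = q - 1 := by
      intro i hi
      refine h.ncard_affinePoints_of_not_isSquare hρ ha hb (fun h0 => hs (hzero ?_)) hs
      rw [← h0]
      exact hd.mapsTo hi
    refine ⟨hcount, ?_⟩
    rw [hsum, Finset.sum_const_nat (m := q - 1), Nat.card_Icc]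
    · obtain ⟨m, rfl⟩ := hodd
      rw [show (2 * m + 1 + 1) / 2 + 1 - 1 = m + 1 by omega, Nat.add_sub_cancel,
        show (2 * m + 1) ^ 2 - 1 = 2 * ((m + 1) * (2 * m)) from Nat.sub_eq_of_eq_add (by ring)]
      omega
    · intro i hi
      exact hcount i (by simpa using hi)
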